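/- Let $K$ be a field, $S=K[x_1,\dots,x_n]$ with the standard grading, and for $F\subseteq[n]$ let $P_F=(x_i : i\in F)$. For an ideal $I\subseteq S$ and $k\ge 0$ let $I^{(k)}=\bigcap_{P\in\mathrm{Ass}(S/I)}(I^kS_P\cap S)$ be the $k$-th symbolic power and $\mathcal R_s(I)=\bigoplus_{k\ge0}I^{(k)}t^k\subseteq S[t]$ the symbolic Rees algebra. For a monomial ideal $L$, $\mathcal G(L)$ denotes its set of minimal monomial generators. A monomial ideal $I$ is of *minimal intersection type* if it is a finite intersection of powers of ideals $P_F$ and has no embedded associated primes. Then $I=\bigcap_{i}P_{F_i}^{k_i}$, where the $P_{F_i}$ are the associated primes of $I$ and $k_i\ge1$ is the exponent with $IS_{P_{F_i}}\cap S=P_{F_i}^{k_i}$ (with $k_i=1$ if $I=0$). A vector $\mathbf a\in\mathbb Z_{\ge0}^n$ is a *$k$-cover* of $I$ if $\sum_{j\in F_i}a_j\ge k\,k_i$ for all $i$; a $k$-cover $\mathbf a$ is *indecomposable* if $(\mathbf a,k)\neq(\mathbf 0,0)$ and $(\mathbf a,k)$ is not a sum $(\mathbf a_1,l_1)+(\mathbf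 a_2,l_2)$ with $\mathbf a_j$ an $l_j$-cover and $(\mathbf a_j,l_j)\ne(\mathbf 0,0)$ for $j=1,2$. The ideal $I$ has a *linear cover function* if there are integers $c,d\ge0$ such that $a_1+\cdots+a_n=ck+d$ for every $k\ge1$ and every indecomposable $k$-cover $\mathbf a$ of $I$. Let $w_1,\dots,w_m$ be the minimal monomial generators of the $S$-algebra $\mathcal R_s(I)$, i.e. the monomials $\mathbf x^{\mathbf a}t^k\in\mathcal R_s(I)$ with $k\ge1$ that are not a product of two monomials of $\mathcal R_s(I)$ different from $1$, ordered as $w_1>\dots>w_m$, where $ut^p>vt^q$ if and only if $p>q$, or $p=q$ and $u>_{\rm lex}v$ (lexicographic order with $x_1>\dots>x_n$). Let $T=K[x_1,\dots,x_n,y_1,\dots,y_m]$, let $\varphi:T\to\mathcal R_s(I)$ be the $K$-algebra map with $\varphi(x_i)=x_i$, $\varphi(y_j)=w_j$, and let $J=\ker\varphi$. Let $>$ be the monomial order on $T$ for which $\mathbf y^{\mathbf a}\mathbf x^{\mathbf b}>\mathbf y^{\mathbf a'}\mathbf x^{\mathbf b'}$ if and only if $\mathbf y^{\mathbf a}>_{\rm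 rlex}\mathbf y^{\mathbf a'}$, or $\mathbf y^{\mathbf a}=\mathbf y^{\mathbf a'}$ and $\mathbf x^{\mathbf b}>_{\rm lex}\mathbf x^{\mathbf b'}$; here $>_{\rm rlex}$ is the degree reverse lexicographic order with $y_1>\dots>y_m$. The algebra $\mathcal R_s(I)$ satisfies the *$x$-condition* with respect to $>$ if every minimal monomial generator of the initial ideal $\mathrm{in}_<(J)$ is of the form $vv'$ with $v\in S$ a monomial of degree at most one and $v'$ a monomial in $K[y_1,\dots,y_m]$. **Theorem.** Let $I\subseteq S$ be a monomial ideal of minimal intersection type with a linear cover function. If $\mathcal R_s(I)$ satisfies the $x$-condition with respect to the order $>$ above, then for every $k\ge1$: 1. $I^{(k)}$ is a monomial ideal with linear quotients, that is, $\mathcal G(I^{(k)})$ is finite and can be ordered as $u_1,\dots,u_r$ such that each colon ideal $(u_1,\dots,u_{i-1}):(u_i)$ is generated by a (possibly empty) set of variables; 2. $I^{(k)}$ is componentwise linear, that is, it is homogeneous and for every $d\ge0$ the ideal generated by the homogeneous elements of degree $d$ of $I^{(k)}$ has a $d$-linear resolution, meaning a graded free resolution $\cdots\to F_1\to F_0$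 with each $F_i$ a finite direct sum of copies of $S(-d-i)$. -/

import Mathlib

namespace SymbolicXCondition

open MvPolynomial

noncomputable section

/-! ### Symbolic powers and the symbolic Rees algebra -/

/-- `I R_P ∩ R`, the contraction of the extension of `I` to the localization at the prime `P`. -/
def contractionAt {R : Type*} [CommRing R] (I P : Ideal R) (hP : P.IsPrime) : Ideal R :=
  (I.map (algebraMap R (Localization.AtPrime P))).comap (algebraMap R (Localization.AtPrime P))

/-- The `k`-th symbolic power: the intersection of `I ^ k R_P ∩ R` over `P ∈ Ass(R / I)`
(the usual definition over a Noetherian ring `R`). -/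
def symbolicPower {R : Type*} [CommRing R] (I : Ideal R) (k : ℕ) : Ideal R :=
  ⨅ P : associatedPrimes R (R ⧸ I), contractionAt (I ^ k) P.1 P.2.isPrime

theorem symbolicPower_zero {R : Type*} [CommRing R] (I : Ideal R) : symbolicPower I 0 = ⊤ := by
  simp [symbolicPower, contractionAt, Ideal.map_top]

theorem mul_mem_symbolicPower {R : Type*} [CommRing R] {I : Ideal R} {j k : ℕ} {f g : R}
    (hf : f ∈ symbolicPower I j) (hg : g ∈ symbolicPower I k) :
    f * g ∈ symbolicPower I (j + k) := by
  simp only [symbolicPower, Submodule.mem_iInf, contractionAt, Ideal.mem_comap] at hf hg ⊢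
  intro P
  rw [map_mul, pow_add, Ideal.map_mul]
  exact Ideal.mul_mem_mul (hf P) (hg P)

/-- The symbolic Rees algebra `⨁ I^(k) t^k`, as a subalgebra of `R[t]`. -/
def symbolicRees {R : Type*} [CommRing R] (I : Ideal R) : Subalgebra R (Polynomial R) where
  carrier := {f | ∀ k, f.coeff k ∈ symbolicPower I k}
  mul_mem' hf hg k := by
    rw [Polynomial.coeff_mul]
    refine Ideal.sum_mem _ ?_
    rintro ⟨i, j⟩ e
    rw [← Finset.HasAntidiagonal.mem_antidiagonal.mp e]
    exact mul_mem_symbolicPower (hf i) (hg j)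
  add_mem' hf hg k := by
    rw [Polynomial.coeff_add]
    exact Ideal.add_mem _ (hf k) (hg k)
  algebraMap_mem' r k := by
    rw [Polynomial.algebraMap_apply, Polynomial.coeff_C]
    split_ifs with h
    · subst h
      simp [symbolicPower_zero]
    · simp

theorem monomial_mem_symbolicRees {R : Type*} [CommRing R] {I : Ideal R} {k : ℕ} {r : R}
    (hr : r ∈ symbolicPower I k) : Polynomial.monomial k r ∈ symbolicRees I := by
  intro j
  rw [Polynomial.coeff_monomial]
  split_ifs with h
  · exact h ▸ hr
  · exact Ideal.zero_mem _

/-! ### Monomial ideals -/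

/-- A monomial ideal: an ideal generated by monomials. -/
def IsMonomialIdeal {σ K : Type*} [Field K] (I : Ideal (MvPolynomial σ K)) : Prop :=
  ∃ A : Set (σ →₀ ℕ), I = Ideal.span ((fun a => monomial a (1 : K)) '' A)

/-- The exponent vectors of the minimal monomial generators of a monomial ideal: the monomials of
the ideal that are minimal with respect to divisibility. -/
def minGens {σ K : Type*} [Field K] (I : Ideal (MvPolynomial σ K)) : Set (σ →₀ ℕ) :=
  {a | monomial a (1 : K) ∈ I ∧ ∀ b, b ≤ a → monomial b (1 : K) ∈ I → b = a}

/-- The ideal generated by the variables `x_i`, `i ∈ F`. These are the monomial prime ideals. -/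
def varIdeal (K : Type*) [Field K] {n : ℕ} (F : Finset (Fin n)) :
    Ideal (MvPolynomial (Fin n) K) :=
  Ideal.span (X '' (F : Set (Fin n)))

/-- `I` is an intersection of (finitely many) powers of monomial prime ideals. -/
def IsIntersectionType {K : Type*} [Field K] {n : ℕ} (I : Ideal (MvPolynomial (Fin n) K)) :
    Prop :=
  ∃ Q : Finset (Finset (Fin n) × ℕ), I = ⨅ p ∈ Q, varIdeal K p.1 ^ p.2

/-- `I` is of intersection type and has no embedded associated primes. -/
def IsMinimalIntersectionType {K : Type*} [Field K] {n : ℕ}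
    (I : Ideal (MvPolynomial (Fin n) K)) : Prop :=
  IsIntersectionType I ∧
    ∀ P ∈ associatedPrimes (MvPolynomial (Fin n) K) (MvPolynomial (Fin n) K ⧸ I),
      P ∈ I.minimalPrimes

/-! ### Vertex covers of the weighted simplicial complex of `I` -/

/-- The facets of `Δ(I)`: the supports of the associated (monomial) primes of `I`. -/
def facets {K : Type*} [Field K] {n : ℕ} (I : Ideal (MvPolynomial (Fin n) K)) :
    Set (Finset (Fin n)) :=
  {F | varIdeal K F ∈ associatedPrimes (MvPolynomial (Fin n) K) (MvPolynomial (Fin n) K ⧸ I)}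

/-- The weight of the facet `F`: if `I = ⋂ P_i ^ k_i` is of minimal intersection type and
`P_i = P_F`, then `I S_{P_i} ∩ S = P_i ^ k_i`, and the weight of `F` is the exponent `k_i`.
(For `F ≠ ∅` there is exactly one such exponent; for the zero ideal it is taken to be `1`.) -/
def weight {K : Type*} [Field K] {n : ℕ} (I : Ideal (MvPolynomial (Fin n) K))
    (F : Finset (Fin n)) : ℕ :=
  sInf {k | 0 < k ∧ ∃ hP : (varIdeal K F).IsPrime,
    contractionAt I (varIdeal K F) hP = varIdeal K F ^ k}

/-- `a` is a vertex cover of order `k` of the complex with facets `Φ` and weights `w`. -/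
def IsCover {n : ℕ} (Φ : Set (Finset (Fin n))) (w : Finset (Fin n) → ℕ) (k : ℕ)
    (a : Fin n →₀ ℕ) : Prop :=
  ∀ F ∈ Φ, k * w F ≤ ∑ i ∈ F, a i

/-- `(a, k)` is a nonzero element of the set `M` of pairs that is not a sum of two nonzero elements
of `M`. -/
def IsIndecomposable {n : ℕ} (M : Set ((Fin n →₀ ℕ) × ℕ)) (p : (Fin n →₀ ℕ) × ℕ) : Prop :=
  p ∈ M ∧ p ≠ 0 ∧ ∀ q ∈ M, ∀ r ∈ M, p = q + r → q = 0 ∨ r = 0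

/-- There are integers `c, d ≥ 0` such that `|a| = c k + d` for every `k ≥ 1` and every
indecomposable `k`-cover `a` of `(Δ(I), w)`. -/
def HasLinearCoverFunction {K : Type*} [Field K] {n : ℕ}
    (I : Ideal (MvPolynomial (Fin n) K)) : Prop :=
  ∃ c d : ℕ, ∀ (k : ℕ) (a : Fin n →₀ ℕ), 1 ≤ k →
    IsIndecomposable {p | IsCover (facets I) (weight I) p.2 p.1} (a, k) →
      ∑ i, a i = c * k + d

/-! ### The presentation of the symbolic Rees algebra -/

/-- The minimal monomial generators `x^a t^k` (`k ≥ 1`) of the symbolic Rees algebra as an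
`S`-algebra: the monomials of positive `t`-degree in it that are not the product of two monomials
of the algebra different from `1`. -/
abbrev ReesGen {K : Type*} [Field K] {n : ℕ} (I : Ideal (MvPolynomial (Fin n) K)) : Type :=
  {p : (Fin n →₀ ℕ) × ℕ // 1 ≤ p.2 ∧
    IsIndecomposable {q | monomial q.1 (1 : K) ∈ symbolicPower I q.2} p}

/-- The polynomial ring `T`: one variable `x_i` for each variable of `S` and one variable `y_w` for
each minimal monomial generator `w` of the symbolic Rees algebra. -/
abbrev PresRing {K : Type*} [Field K] {n : ℕ} (I : Ideal (MvPolynomial (Fin n) K)) : Type _ :=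
  MvPolynomial (Fin n ⊕ ReesGen I) K

/-- The map `φ : T → R_s(I)` with `x_i ↦ x_i` and `y_w ↦ w`. -/
def presMap {K : Type*} [Field K] {n : ℕ} (I : Ideal (MvPolynomial (Fin n) K)) :
    PresRing I →ₐ[K] symbolicRees I :=
  aeval (Sum.elim
    (fun i => algebraMap (MvPolynomial (Fin n) K) (symbolicRees I) (X i))
    (fun w => ⟨Polynomial.monomial w.1.2 (monomial w.1.1 1),
      monomial_mem_symbolicRees w.2.2.1⟩))

/-- The defining ideal `J = Ker φ` of the symbolic Rees algebra. -/
def definingIdeal {K : Type*} [Field K] {n : ℕ} (I : Ideal (MvPolynomial (Fin n) K)) :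
    Ideal (PresRing I) :=
  RingHom.ker (presMap I)

/-- `a <_lex b` for exponent vectors, for the lexicographic order with `x_1 > ⋯ > x_n`. -/
def LexLT {n : ℕ} (a b : Fin n →₀ ℕ) : Prop :=
  ∃ i, (∀ j < i, a j = b j) ∧ a i < b i

/-- The order on the variables `y`: `y_w < y_w'` for `w = x^a t^p` and `w' = x^b t^q` iff `p < q`,
or `p = q` and `x^a <_lex x^b`. -/
def GenLT {K : Type*} [Field K] {n : ℕ} {I : Ideal (MvPolynomial (Fin n) K)}
    (w w' : ReesGen I) : Prop :=
  w.1.2 < w'.1.2 ∨ (w.1.2 = w'.1.2 ∧ LexLT w.1.1 w'.1.1)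

/-- `g <_rlex h` for monomials in variables `Y` ordered by `lt`: the (degree) reverse lexicographic
order. Either `deg g < deg h`, or the degrees agree and the smallest variable with different
exponents in `g` and `h` has the larger exponent in `g`. -/
def RevLexLT {Y : Type*} (lt : Y → Y → Prop) (g h : Y →₀ ℕ) : Prop :=
  g.degree < h.degree ∨
    (g.degree = h.degree ∧ ∃ y, (∀ z, lt z y → g z = h z) ∧ h y < g y)

/-- The part in the variables `x` of a monomial of `T`. -/
def xPart {α β : Type*} (m : α ⊕ β →₀ ℕ) : α →₀ ℕ := m.comapDomain Sum.inl Sum.inl_injective.injOn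

/-- The part in the variables `y` of a monomial of `T`. -/
def yPart {α β : Type*} (m : α ⊕ β →₀ ℕ) : β →₀ ℕ := m.comapDomain Sum.inr Sum.inr_injective.injOn

/-- The monomial order on `T`: compare the `y`-parts by the reverse lexicographic order, then the
`x`-parts by the lexicographic order. -/
def OrderTLT {K : Type*} [Field K] {n : ℕ} (I : Ideal (MvPolynomial (Fin n) K))
    (m m' : Fin n ⊕ ReesGen I →₀ ℕ) : Prop :=
  RevLexLT GenLT (yPart m) (yPart m') ∨ (yPart m = yPart m' ∧ LexLT (xPart m) (xPart m'))

/-- `m` is the initial monomial of `f`, i.e. the largest monomial in the support of `f`. -/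
def IsInitialMonomial {τ K : Type*} [Field K] (lt : (τ →₀ ℕ) → (τ →₀ ℕ) → Prop)
    (f : MvPolynomial τ K) (m : τ →₀ ℕ) : Prop :=
  m ∈ f.support ∧ ∀ m' ∈ f.support, m' ≠ m → lt m' m

/-- The initial ideal of `J`, generated by the initial monomials of the nonzero elements of `J`. -/
def initialIdeal {τ K : Type*} [Field K] (lt : (τ →₀ ℕ) → (τ →₀ ℕ) → Prop)
    (J : Ideal (MvPolynomial τ K)) : Ideal (MvPolynomial τ K) :=
  Ideal.span {u | ∃ f ∈ J, ∃ m, IsInitialMonomial lt f m ∧ u = monomial m 1}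

/-- The `x`-condition for the symbolic Rees algebra with respect to a monomial order on `T`: every
minimal monomial generator of the initial ideal of `J` has `x`-part of degree at most one. -/
def XCondition {K : Type*} [Field K] {n : ℕ} (I : Ideal (MvPolynomial (Fin n) K))
    (lt : (Fin n ⊕ ReesGen I →₀ ℕ) → (Fin n ⊕ ReesGen I →₀ ℕ) → Prop) : Prop :=
  ∀ m ∈ minGens (initialIdeal lt (definingIdeal I)), (xPart m).degree ≤ 1

/-! ### Linear quotients and componentwise linear ideals -/

/-- The monomial ideal `I` has linear quotients: its minimal monomial generators can be ordered
`u_1, …, u_r` such that every colon ideal `(u_1, …, u_{i-1}) : (u_i)` is generated by variables. -/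
def HasLinearQuotients {K : Type*} [Field K] {n : ℕ} (I : Ideal (MvPolynomial (Fin n) K)) :
    Prop :=
  IsMonomialIdeal I ∧
    ∃ (r : ℕ) (u : Fin r → (Fin n →₀ ℕ)), Function.Injective u ∧ Set.range u = minGens I ∧
      ∀ i, ∃ V : Finset (Fin n),
        (Ideal.span ((fun j => monomial (u j) (1 : K)) '' {j | j < i})).colon
          {monomial (u i) (1 : K)} = varIdeal K V

/-- `I` is generated in degree `d` and has a linear resolution: a graded free resolution
`⋯ → F_2 → F_1 → F_0 → I → 0` with `F_i = S(-d-i)^{β_i}`. Such a resolution is given by finitely many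
generators `g` of `I` that are homogeneous of degree `d` and by matrices `A i` (acting on row
vectors, from `F_{i+1}` to `F_i`) whose entries are linear forms, with exactness at each `F_i`.
It is automatically minimal. -/
def HasLinearResolution {K : Type*} [Field K] {n : ℕ} (d : ℕ)
    (I : Ideal (MvPolynomial (Fin n) K)) : Prop :=
  ∃ (β : ℕ → Type) (_ : ∀ i, Fintype (β i)) (g : β 0 → MvPolynomial (Fin n) K)
    (A : ∀ i, Matrix (β (i + 1)) (β i) (MvPolynomial (Fin n) K)),
    (∀ j, (g j).IsHomogeneous d) ∧
    (∀ i p q, (A i p q).IsHomogeneous 1) ∧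
    Ideal.span (Set.range g) = I ∧
    (∀ v : β 0 → MvPolynomial (Fin n) K,
      ∑ j, v j * g j = 0 ↔ ∃ w, v = Matrix.vecMul w (A 0)) ∧
    (∀ i, ∀ v : β (i + 1) → MvPolynomial (Fin n) K,
      Matrix.vecMul v (A i) = 0 ↔ ∃ w, v = Matrix.vecMul w (A (i + 1)))

/-- `I_⟨d⟩`, the ideal generated by the homogeneous elements of degree `d` of `I`. -/
def gradedPartIdeal {K : Type*} [Field K] {n : ℕ} (I : Ideal (MvPolynomial (Fin n) K)) (d : ℕ) :
    Ideal (MvPolynomial (Fin n) K) :=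
  Ideal.span {f | f ∈ I ∧ f.IsHomogeneous d}

/-- The homogeneous ideal `I` is componentwise linear: `I_⟨d⟩` has a linear resolution for all
`d`. -/
def IsComponentwiseLinear {K : Type*} [Field K] {n : ℕ} (I : Ideal (MvPolynomial (Fin n) K)) :
    Prop :=
  (∀ f ∈ I, ∀ d, homogeneousComponent d f ∈ I) ∧ ∀ d, HasLinearResolution d (gradedPartIdeal I d)

end

end SymbolicXCondition

/-! Because `I` has no embedded primes, localizing at an associated prime `P_F` shows that a
polynomial lies in the `k`-th symbolic power exactly when all its exponent vectors are `k`-covers.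
So symbolic powers are spanned by monomials, and the `y`-variables correspond to the indecomposable
covers of positive order.

The kernel `J` is toric: a monomial lies in its initial ideal iff a smaller monomial has the same
image. A minimal generator `u` of the `k`-th symbolic power has no spare `x`-factor, so `u t^k` is
the image of some pure monomial `y^c`; take the reverse lexicographically smallest such `c`, and
order the `u`'s by their `c`. If an earlier `u'` divides `p u`, then `x^p y^c` is in the initial
ideal. By the `x`-condition a generator of that ideal with at most one `x`-variable divides it; by
minimality of `c` there is exactly one, `x_s`, and it divides `x^p`. This gives `c'' < c` whose
image divides `x_s u t^k` (`exists_exchange_of_xCondition`). That image need not be a minimal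
generator. The linear cover function makes its degree `C k + d |c''|`, so passing to a proper
divisor decreases the number of `y`-factors, hence the order. Thus the colon ideals are generated by
variables (`exists_monomialQuotients`), and the generators appear in nondecreasing degree.

Monotone degrees let linear quotients pass to each degree component (`exists_degreePart`). For a
sequence with linear quotients in a single degree, the linear syzygies generate all syzygies and
again have linear quotients (`exists_syzygies`); iterating builds the linear resolution. -/

namespace SymbolicXCondition

open MvPolynomial

noncomputable section

/-! ### Powers of monomial primes -/

section VarIdeal

variable {K : Type*} [Field K] {n : ℕ}

/-- The substitution `x_i ↦ x_i t` for `i ∈ F` and `x_i ↦ x_i` for `i ∉ F`. -/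
def scaleVars (K : Type*) [Field K] {n : ℕ} (F : Finset (Fin n)) :
    MvPolynomial (Fin n) K →ₐ[K] Polynomial (MvPolynomial (Fin n) K) :=
  aeval fun i => if i ∈ F then Polynomial.X * Polynomial.C (X i) else Polynomial.C (X i)

theorem scaleVars_monomial (F : Finset (Fin n)) (a : Fin n →₀ ℕ) (c : K) :
    scaleVars K F (monomial a c) = Polynomial.monomial (∑ i ∈ F, a i) (monomial a c) := by
  have h : ∀ i : Fin n, (if i ∈ F then Polynomial.X * Polynomial.C (X i : MvPolynomial (Fin n) K)
      else Polynomial.C (X i)) ^ a i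
      = (if i ∈ F then Polynomial.X ^ a i else 1) * Polynomial.C (X i ^ a i) := by
    intro i
    split_ifs
    · rw [mul_pow, map_pow]
    · rw [one_mul, map_pow]
  rw [scaleVars, aeval_monomial, Finsupp.prod_fintype _ _ (by simp)]
  simp only [h, Finset.prod_mul_distrib]
  rw [Finset.prod_ite_mem, Finset.univ_inter, Finset.prod_pow_eq_pow_sum, ← map_prod,
    monomial_eq, Finsupp.prod_fintype _ _ (by simp), ← Polynomial.C_mul_X_pow_eq_monomial, map_mul]
  have : algebraMap K (Polynomial (MvPolynomial (Fin n) K)) c = Polynomial.C (C c) := rfl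
  rw [this]
  ring

theorem coeff_coeff_scaleVars (F : Finset (Fin n)) (f : MvPolynomial (Fin n) K) (d : ℕ)
    (a : Fin n →₀ ℕ) :
    coeff a ((scaleVars K F f).coeff d) = if ∑ i ∈ F, a i = d then coeff a f else 0 := by
  induction f using MvPolynomial.induction_on' with
  | monomial b c =>
    rw [scaleVars_monomial, Polynomial.coeff_monomial]
    split_ifs with h1 h2 h2
    · rfl
    · rw [coeff_monomial, if_neg]
      rintro rfl
      exact h2 h1
    · rw [coeff_monomial, if_neg, coeff_zero]
      rintro rfl
      exact h1 h2
    · simp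
  | add p q hp hq =>
    rw [map_add, Polynomial.coeff_add, coeff_add, hp, hq, coeff_add]
    split_ifs <;> simp

theorem X_pow_dvd_scaleVars_iff (F : Finset (Fin n)) (f : MvPolynomial (Fin n) K) (m : ℕ) :
    Polynomial.X ^ m ∣ scaleVars K F f ↔ ∀ a ∈ f.support, m ≤ ∑ i ∈ F, a i := by
  rw [Polynomial.X_pow_dvd_iff]
  constructor
  · intro h a ha
    by_contra! hlt
    have := coeff_coeff_scaleVars F f (∑ i ∈ F, a i) a
    rw [if_pos rfl, h _ hlt, coeff_zero] at this
    exact mem_support_iff.mp ha this.symm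
  · intro h d hd
    ext a
    rw [coeff_coeff_scaleVars, coeff_zero]
    split_ifs with hs
    · by_contra hne
      exact absurd (h a (mem_support_iff.mpr hne)) (by omega)
    · rfl

theorem monomial_mem_varIdeal_pow {F : Finset (Fin n)} {a : Fin n →₀ ℕ} {m : ℕ} (c : K)
    (h : m ≤ ∑ i ∈ F, a i) : monomial a c ∈ varIdeal K F ^ m := by
  refine Ideal.pow_le_pow_right h ?_
  have hd : (∏ i ∈ F, (X i : MvPolynomial (Fin n) K) ^ a i) ∣ monomial a c := by
    rw [monomial_eq, Finsupp.prod_fintype _ _ (by simp)]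
    exact Dvd.dvd.mul_left (Finset.prod_dvd_prod_of_subset _ _ _ (Finset.subset_univ F)) _
  refine Ideal.mem_of_dvd _ hd ?_
  rw [← Finset.prod_pow_eq_pow_sum]
  exact Ideal.prod_mem_prod fun i hi =>
    Ideal.pow_mem_pow (Ideal.subset_span (Set.mem_image_of_mem _ hi)) _

/-- The substitution sends each `x_i` with `i ∈ F` into `(t)`. Conversely, divisibility by `t^m`
says that every monomial of `f` has degree at least `m` in the variables of `F`. -/
theorem mem_varIdeal_pow_iff_dvd (F : Finset (Fin n)) (f : MvPolynomial (Fin n) K) (m : ℕ) :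
    f ∈ varIdeal K F ^ m ↔ Polynomial.X ^ m ∣ scaleVars K F f := by
  constructor
  · intro hf
    have h1 : (varIdeal K F).map (scaleVars K F) ≤ Ideal.span {Polynomial.X} := by
      rw [varIdeal, Ideal.map_span, Ideal.span_le]
      rintro _ ⟨_, ⟨i, hi, rfl⟩, rfl⟩
      rw [SetLike.mem_coe, Ideal.mem_span_singleton]
      simp [scaleVars, Finset.mem_coe.mp hi]
    have h2 := Ideal.mem_map_of_mem (scaleVars K F) hf
    rw [Ideal.map_pow] at h2
    have h3 := Ideal.pow_right_mono h1 m h2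
    rwa [Ideal.span_singleton_pow, Ideal.mem_span_singleton] at h3
  · rw [X_pow_dvd_scaleVars_iff]
    intro h
    rw [f.as_sum]
    exact Ideal.sum_mem _ fun a ha => monomial_mem_varIdeal_pow _ (h a ha)

theorem mem_varIdeal_pow_iff (F : Finset (Fin n)) (f : MvPolynomial (Fin n) K) (m : ℕ) :
    f ∈ varIdeal K F ^ m ↔ ∀ a ∈ f.support, m ≤ ∑ i ∈ F, a i := by
  rw [mem_varIdeal_pow_iff_dvd, X_pow_dvd_scaleVars_iff]

theorem mem_varIdeal_iff_dvd (F : Finset (Fin n)) (f : MvPolynomial (Fin n) K) :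
    f ∈ varIdeal K F ↔ Polynomial.X ∣ scaleVars K F f := by
  simpa using mem_varIdeal_pow_iff_dvd F f 1

/-- Powers of `P_F` are primary because `t` is a prime element of `S[t]`. -/
theorem mem_varIdeal_pow_of_mul_mem {F : Finset (Fin n)} {s f : MvPolynomial (Fin n) K} {m : ℕ}
    (hs : s ∉ varIdeal K F) (h : s * f ∈ varIdeal K F ^ m) : f ∈ varIdeal K F ^ m := by
  rw [mem_varIdeal_iff_dvd] at hs
  rw [mem_varIdeal_pow_iff_dvd] at h ⊢
  rw [map_mul] at h
  exact Polynomial.prime_X.pow_dvd_of_dvd_mul_left m hs h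

theorem mem_varIdeal_iff (V : Finset (Fin n)) (f : MvPolynomial (Fin n) K) :
    f ∈ varIdeal K V ↔ ∀ a ∈ f.support, ∃ s ∈ V, a s ≠ 0 :=
  mem_ideal_span_X_image

end VarIdeal

/-! ### Symbolic powers in terms of covers -/

section SymbolicPower

theorem mem_contractionAt {R : Type*} [CommRing R] {I P : Ideal R} {hP : P.IsPrime} {f : R} :
    f ∈ contractionAt I P hP ↔ ∃ s ∉ P, s * f ∈ I := by
  rw [contractionAt, Ideal.mem_comap,
    IsLocalization.algebraMap_mem_map_algebraMap_iff P.primeCompl]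
  rfl

theorem map_contractionAt {R : Type*} [CommRing R] (I P : Ideal R) (hP : P.IsPrime) :
    (contractionAt I P hP).map (algebraMap R (Localization.AtPrime P))
      = I.map (algebraMap R (Localization.AtPrime P)) :=
  IsLocalization.map_under P.primeCompl _ _

variable {K : Type*} [Field K] {n : ℕ} {I : Ideal (MvPolynomial (Fin n) K)}

theorem exists_varIdeal_le_of_iInf_le {Q : Finset (Finset (Fin n) × ℕ)}
    {P : Ideal (MvPolynomial (Fin n) K)} (hP : P.IsPrime)
    (h : ⨅ p ∈ Q, varIdeal K p.1 ^ p.2 ≤ P) : ∃ p ∈ Q, p.2 ≠ 0 ∧ varIdeal K p.1 ≤ P := by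
  rw [← Finset.inf_eq_iInf] at h
  obtain ⟨p, hp, hle⟩ := (Ideal.IsPrime.inf_le' hP).mp h
  refine ⟨p, hp, ?_, Ideal.IsPrime.le_of_pow_le hle⟩
  intro h0
  rw [h0, pow_zero, Ideal.one_eq_top] at hle
  exact hP.ne_top (top_le_iff.mp hle)

theorem varIdeal_isPrime (F : Finset (Fin n)) : (varIdeal K F).IsPrime := by
  have h : varIdeal K F = (Ideal.span {Polynomial.X}).comap (scaleVars K F) := by
    ext f
    rw [mem_varIdeal_iff_dvd, Ideal.mem_comap, Ideal.mem_span_singleton]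
  have hX : (Ideal.span {(Polynomial.X : Polynomial (MvPolynomial (Fin n) K))}).IsPrime :=
    (Ideal.span_singleton_prime Polynomial.X_ne_zero).mpr Polynomial.prime_X
  rw [h]
  exact Ideal.comap_isPrime _ _

theorem eq_varIdeal_of_mem_minimalPrimes {Q : Finset (Finset (Fin n) × ℕ)}
    {P : Ideal (MvPolynomial (Fin n) K)}
    (hP : P ∈ (⨅ p ∈ Q, varIdeal K p.1 ^ p.2).minimalPrimes) {p : Finset (Fin n) × ℕ}
    (hp : p ∈ Q) (h0 : p.2 ≠ 0) (hle : varIdeal K p.1 ≤ P) : varIdeal K p.1 = P :=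
  le_antisymm hle (hP.2 ⟨varIdeal_isPrime _, (iInf₂_le p hp).trans (Ideal.pow_le_self h0)⟩ hle)

theorem IsMinimalIntersectionType.exists_eq_varIdeal (hI : IsMinimalIntersectionType I)
    {P : Ideal (MvPolynomial (Fin n) K)}
    (hP : P ∈ associatedPrimes (MvPolynomial (Fin n) K) (MvPolynomial (Fin n) K ⧸ I)) :
    ∃ F, P = varIdeal K F := by
  obtain ⟨⟨Q, rfl⟩, hmin⟩ := hI
  have hPm := hmin P hP
  obtain ⟨p, hp, h0, hle⟩ := exists_varIdeal_le_of_iInf_le hPm.1.1 hPm.1.2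
  exact ⟨p.1, (eq_varIdeal_of_mem_minimalPrimes hPm hp h0 hle).symm⟩

/-- Since `P_F` is minimal over `I`, every component with another radical contains an element
outside `P_F` and disappears in the localization. Among the components that are powers of `P_F`, the
largest exponent wins. -/
theorem IsMinimalIntersectionType.exists_contractionAt_eq (hI : IsMinimalIntersectionType I)
    {F : Finset (Fin n)} (hF : F ∈ facets I) :
    ∃ k, 0 < k ∧ ∃ hP : (varIdeal K F).IsPrime,
      contractionAt I (varIdeal K F) hP = varIdeal K F ^ k := by
  classical
  obtain ⟨⟨Q, rfl⟩, hmin⟩ := hI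
  have hPm := hmin _ hF
  have hprime := varIdeal_isPrime (K := K) F
  set Q' := Q.filter fun p => varIdeal K p.1 = varIdeal K F
  obtain ⟨p₀, hp₀, h0, hle⟩ := exists_varIdeal_le_of_iInf_le hPm.1.1 hPm.1.2
  have hp₀' : p₀ ∈ Q' :=
    Finset.mem_filter.mpr ⟨hp₀, eq_varIdeal_of_mem_minimalPrimes hPm hp₀ h0 hle⟩
  obtain ⟨q, hq, hmax⟩ := Q'.exists_max_image (fun p => p.2) ⟨p₀, hp₀'⟩
  have hq' := Finset.mem_filter.mp hq
  refine ⟨q.2, (Nat.pos_of_ne_zero h0).trans_le (hmax _ hp₀'), hprime, ?_⟩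
  ext f
  rw [mem_contractionAt]
  constructor
  · rintro ⟨s, hs, hsf⟩
    have := (Submodule.mem_iInf _).mp ((Submodule.mem_iInf _).mp hsf q) hq'.1
    rw [hq'.2] at this
    exact mem_varIdeal_pow_of_mul_mem hs this
  · intro hf
    -- A multiplier is found for each component separately; their product stays outside the prime
    -- `P_F` and works for all components at once.
    have key : ∀ p ∈ Q, ∃ s ∉ varIdeal K F, s * f ∈ varIdeal K p.1 ^ p.2 := by
      intro p hp
      by_cases hpF : varIdeal K p.1 = varIdeal K F
      · refine ⟨1, (Ideal.ne_top_iff_one _).mp hprime.ne_top, ?_⟩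
        rw [one_mul, hpF]
        exact Ideal.pow_le_pow_right (hmax p (Finset.mem_filter.mpr ⟨hp, hpF⟩)) hf
      · by_cases hp0 : p.2 = 0
        · refine ⟨1, (Ideal.ne_top_iff_one _).mp hprime.ne_top, ?_⟩
          simp [hp0]
        · have hnle : ¬ varIdeal K p.1 ≤ varIdeal K F := fun hle =>
            hpF (eq_varIdeal_of_mem_minimalPrimes hPm hp hp0 hle)
          obtain ⟨s, hs, hsF⟩ := SetLike.not_le_iff_exists.mp hnle
          exact ⟨s ^ p.2, fun h => hsF (hprime.mem_of_pow_mem _ h),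
            Ideal.mul_mem_right _ _ (Ideal.pow_mem_pow hs _)⟩
    choose! s hs hsf using key
    refine ⟨∏ p ∈ Q, s p, ?_, ?_⟩
    · rw [Ideal.IsPrime.prod_mem_iff]
      rintro ⟨p, hp, hmem⟩
      exact hs p hp hmem
    · refine (Submodule.mem_iInf _).mpr fun p => (Submodule.mem_iInf _).mpr fun hp => ?_
      rw [← Finset.prod_erase_mul _ _ hp, mul_assoc]
      exact Ideal.mul_mem_left _ _ (hsf p hp)

/-- Extension to the localization commutes with powers, and powers of `P_F`, being primary, are
unchanged by extension and contraction. -/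
theorem IsMinimalIntersectionType.contractionAt_pow (hI : IsMinimalIntersectionType I)
    {F : Finset (Fin n)} (hF : F ∈ facets I) (hP : (varIdeal K F).IsPrime) (k : ℕ) :
    contractionAt (I ^ k) (varIdeal K F) hP = varIdeal K F ^ (k * weight I F) := by
  obtain ⟨-, hP', hw⟩ := Nat.sInf_mem (s := {k | 0 < k ∧ ∃ hP : (varIdeal K F).IsPrime,
    contractionAt I (varIdeal K F) hP = varIdeal K F ^ k}) (hI.exists_contractionAt_eq hF)
  have hw' : contractionAt I (varIdeal K F) hP = varIdeal K F ^ weight I F := hw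
  have hmap := map_contractionAt I (varIdeal K F) hP
  have h1 : contractionAt (I ^ k) (varIdeal K F) hP
      = contractionAt (varIdeal K F ^ (k * weight I F)) (varIdeal K F) hP := by
    rw [contractionAt, Ideal.map_pow, ← hmap, hw', ← Ideal.map_pow, ← pow_mul, mul_comm]
    rfl
  rw [h1]
  ext f
  rw [mem_contractionAt]
  constructor
  · rintro ⟨s, hs, hsf⟩
    exact mem_varIdeal_pow_of_mul_mem hs hsf
  · intro hf
    exact ⟨1, (Ideal.ne_top_iff_one _).mp hP.ne_top, by rwa [one_mul]⟩

theorem IsMinimalIntersectionType.mem_symbolicPower_iff (hI : IsMinimalIntersectionType I)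
    (k : ℕ) (f : MvPolynomial (Fin n) K) :
    f ∈ symbolicPower I k ↔ ∀ a ∈ f.support, IsCover (facets I) (weight I) k a := by
  rw [symbolicPower, Submodule.mem_iInf]
  constructor
  · intro h a ha F hF
    have h1 := h ⟨varIdeal K F, hF⟩
    rw [hI.contractionAt_pow hF, mem_varIdeal_pow_iff] at h1
    exact h1 a ha
  · rintro h ⟨P, hP⟩
    obtain ⟨F, rfl⟩ := hI.exists_eq_varIdeal hP
    rw [hI.contractionAt_pow hP, mem_varIdeal_pow_iff]
    exact fun a ha => h a ha F hP

theorem IsMinimalIntersectionType.monomial_mem_symbolicPower_iff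
    (hI : IsMinimalIntersectionType I) (k : ℕ) (a : Fin n →₀ ℕ) :
    monomial a (1 : K) ∈ symbolicPower I k ↔ IsCover (facets I) (weight I) k a := by
  classical
  rw [hI.mem_symbolicPower_iff, support_monomial, if_neg one_ne_zero]
  simp

theorem IsMinimalIntersectionType.mem_symbolicPower_iff_monomial
    (hI : IsMinimalIntersectionType I) (k : ℕ) (f : MvPolynomial (Fin n) K) :
    f ∈ symbolicPower I k ↔ ∀ a ∈ f.support, monomial a (1 : K) ∈ symbolicPower I k := by
  simp only [hI.monomial_mem_symbolicPower_iff, hI.mem_symbolicPower_iff]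

end SymbolicPower

/-! ### The reverse lexicographic order -/

section RevLex

variable {Y α : Type*} [LinearOrder α] {lt : Y → Y → Prop} {κ : Y → α}

theorem RevLexLT.irrefl (lt : Y → Y → Prop) (g : Y →₀ ℕ) : ¬ RevLexLT lt g g := by
  rintro (h | ⟨-, y, -, h⟩) <;> exact lt_irrefl _ h

theorem RevLexLT.add_right {g h : Y →₀ ℕ} (H : RevLexLT lt g h) (e : Y →₀ ℕ) :
    RevLexLT lt (g + e) (h + e) := by
  rcases H with H | ⟨H, y, hy, hlt⟩
  · left
    simpa [map_add] using H
  · refine Or.inr ⟨by simp [map_add, H], y, fun z hz => ?_, ?_⟩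
    · simp [hy z hz]
    · simpa using hlt

theorem RevLexLT.trans (hlt : ∀ a b, lt a b ↔ κ a < κ b) (hκ : Function.Injective κ)
    {f g h : Y →₀ ℕ} (H : RevLexLT lt f g) (H' : RevLexLT lt g h) : RevLexLT lt f h := by
  rcases H with H | ⟨H, y, hy, hl⟩ <;> rcases H' with H' | ⟨H', z, hz, hl'⟩
  · exact Or.inl (H.trans H')
  · exact Or.inl (H' ▸ H)
  · exact Or.inl (H ▸ H')
  · refine Or.inr ⟨H.trans H', ?_⟩
    simp only [hlt] at hy hz ⊢
    rcases lt_trichotomy (κ y) (κ z) with h1 | h1 | h1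
    · exact ⟨y, fun w hw => (hy w hw).trans (hz w (hw.trans h1)), by rw [← hz y h1]; exact hl⟩
    · obtain rfl := hκ h1
      exact ⟨y, fun w hw => (hy w hw).trans (hz w hw), hl'.trans hl⟩
    · exact ⟨z, fun w hw => (hy w (hw.trans h1)).trans (hz w hw), by rw [hy z h1]; exact hl'⟩

/-- Two monomials differ in finitely many exponents, so a smallest variable of disagreement exists
even if there are infinitely many variables. -/
theorem RevLexLT.trichotomy (hlt : ∀ a b, lt a b ↔ κ a < κ b) {g h : Y →₀ ℕ} (hne : g ≠ h) :
    RevLexLT lt g h ∨ RevLexLT lt h g := by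
  classical
  rcases lt_trichotomy g.degree h.degree with hd | hd | hd
  · exact Or.inl (Or.inl hd)
  · obtain ⟨y, hy, hmin⟩ := (g.neLocus h).exists_min_image κ
      (Finsupp.nonempty_neLocus_iff.mpr hne)
    have heq : ∀ z, lt z y → g z = h z := by
      intro z hz
      by_contra hzne
      exact absurd (hmin z (Finsupp.mem_neLocus.mpr hzne)) (not_le.mpr ((hlt _ _).mp hz))
    rcases lt_or_gt_of_ne (Finsupp.mem_neLocus.mp hy) with h1 | h1
    · exact Or.inr (Or.inr ⟨hd.symm, y, fun z hz => (heq z hz).symm, h1⟩)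
    · exact Or.inl (Or.inr ⟨hd, y, heq, h1⟩)
  · exact Or.inr (Or.inl hd)

end RevLex

theorem exists_mem_minGens_le {σ K : Type*} [Field K] {I : Ideal (MvPolynomial σ K)} {a : σ →₀ ℕ}
    (ha : monomial a (1 : K) ∈ I) : ∃ b ∈ minGens I, b ≤ a := by
  obtain ⟨b, ⟨hb, hba⟩, hmin⟩ := WellFounded.has_min (wellFounded_lt (α := σ →₀ ℕ))
    {b | monomial b (1 : K) ∈ I ∧ b ≤ a} ⟨a, ha, le_rfl⟩
  refine ⟨b, ⟨hb, fun c hcb hc => ?_⟩, hba⟩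
  by_contra hne
  exact hmin c ⟨hc, hcb.trans hba⟩ (lt_of_le_of_ne hcb hne)

theorem finite_minGens {K : Type*} [Field K] {n : ℕ} (I : Ideal (MvPolynomial (Fin n) K)) :
    (minGens I).Finite := by
  refine IsAntichain.finite_of_partiallyWellOrderedOn (r := (· ≤ ·)) ?_ (Set.isPWO_of_wellQuasiOrderedLE _)
  intro a ha b hb hne hab
  exact hne (hb.2 a hab ha.1)

theorem monomial_mem_of_le {σ K : Type*} [Field K] {I : Ideal (MvPolynomial σ K)} {a b : σ →₀ ℕ}
    (hab : a ≤ b) (ha : monomial a (1 : K) ∈ I) : monomial b (1 : K) ∈ I :=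
  Ideal.mem_of_dvd _ (monomial_dvd_monomial.mpr ⟨Or.inr hab, one_dvd _⟩) ha

section Parts

variable {α β : Type*}

@[simp] theorem xPart_zero : xPart (0 : α ⊕ β →₀ ℕ) = 0 := by
  ext; simp [xPart]

@[simp] theorem yPart_zero : yPart (0 : α ⊕ β →₀ ℕ) = 0 := by
  ext; simp [yPart]

theorem xPart_add (m m' : α ⊕ β →₀ ℕ) : xPart (m + m') = xPart m + xPart m' := by
  ext; simp [xPart]

theorem yPart_add (m m' : α ⊕ β →₀ ℕ) : yPart (m + m') = yPart m + yPart m' := by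
  ext; simp [yPart]

@[simp] theorem xPart_sumElim (b : α →₀ ℕ) (c : β →₀ ℕ) : xPart (b.sumElim c) = b := by
  ext; simp [xPart]

@[simp] theorem yPart_sumElim (b : α →₀ ℕ) (c : β →₀ ℕ) : yPart (b.sumElim c) = c := by
  ext; simp [yPart]

@[simp] theorem xPart_single_inl (i : α) (k : ℕ) :
    xPart (Finsupp.single (Sum.inl i : α ⊕ β) k) = Finsupp.single i k := by
  rw [← Finsupp.sumElim_single_zero, xPart_sumElim]

@[simp] theorem yPart_single_inl (i : α) (k : ℕ) :
    yPart (Finsupp.single (Sum.inl i : α ⊕ β) k) = 0 := by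
  rw [← Finsupp.sumElim_single_zero, yPart_sumElim]

@[simp] theorem xPart_single_inr (i : β) (k : ℕ) :
    xPart (Finsupp.single (Sum.inr i : α ⊕ β) k) = 0 := by
  rw [← Finsupp.sumElim_zero_single, xPart_sumElim]

@[simp] theorem yPart_single_inr (i : β) (k : ℕ) :
    yPart (Finsupp.single (Sum.inr i : α ⊕ β) k) = Finsupp.single i k := by
  rw [← Finsupp.sumElim_zero_single, yPart_sumElim]

theorem xPart_mono {m m' : α ⊕ β →₀ ℕ} (h : m ≤ m') : xPart m ≤ xPart m' := fun i => h (Sum.inl i)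

theorem yPart_mono {m m' : α ⊕ β →₀ ℕ} (h : m ≤ m') : yPart m ≤ yPart m' := fun i => h (Sum.inr i)

end Parts

/-! ### The toric ideal `J` and its initial ideal -/

section Presentation

variable {K : Type*} [Field K] {n : ℕ} (I : Ideal (MvPolynomial (Fin n) K))

theorem lexLT_iff (a b : Fin n →₀ ℕ) : LexLT a b ↔ toLex a < toLex b :=
  Finsupp.Lex.lt_iff.symm

theorem LexLT.add_right {a b : Fin n →₀ ℕ} (h : LexLT a b) (c : Fin n →₀ ℕ) :
    LexLT (a + c) (b + c) := by
  obtain ⟨i, hi, hlt⟩ := h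
  exact ⟨i, fun j hj => by simp [hi j hj], by simpa using hlt⟩

/-- The key describing the order on the generators of the symbolic Rees algebra. -/
def genKey (w : ReesGen I) : ℕ ×ₗ Lex (Fin n →₀ ℕ) := toLex (w.1.2, toLex w.1.1)

variable {I} in
theorem genLT_iff (w w' : ReesGen I) : GenLT w w' ↔ genKey I w < genKey I w' := by
  rw [GenLT, genKey, genKey, Prod.Lex.toLex_lt_toLex, lexLT_iff]

theorem genKey_injective : Function.Injective (genKey I) := by
  intro w w' h
  have h' := toLex.injective h
  rw [Prod.mk.injEq] at h'
  exact Subtype.ext (Prod.ext (toLex.injective h'.2) h'.1)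

/-- The monomials in the variables `y`, with the reverse lexicographic order. -/
def GenMonomial : Type _ := ReesGen I →₀ ℕ

/-- The reverse lexicographic order on the monomials in the variables `y`. -/
def GenMonomialLT (c c' : GenMonomial I) : Prop := RevLexLT (Y := ReesGen I) GenLT c c'

instance : IsStrictTotalOrder (GenMonomial I) (GenMonomialLT I) where
  irrefl := RevLexLT.irrefl _
  trans := fun _ _ _ => RevLexLT.trans genLT_iff (genKey_injective I)
  trichotomous := fun a b h1 h2 => by
    by_contra hne
    rcases RevLexLT.trichotomy (Y := ReesGen I) genLT_iff hne with h | h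
    exacts [h1 h, h2 h]

instance : LinearOrder (GenMonomial I) :=
  @linearOrderOfSTO _ (GenMonomialLT I) _ (Classical.decRel _)

variable {I} in
theorem genMonomial_lt_iff (c c' : GenMonomial I) :
    c < c' ↔ RevLexLT (Y := ReesGen I) GenLT c c' := Iff.rfl

/-- The pair of the exponent vector and the `t`-degree of the image of a monomial in `y`. -/
def genExp : (ReesGen I →₀ ℕ) →ₗ[ℕ] (Fin n →₀ ℕ) × ℕ :=
  Finsupp.linearCombination ℕ fun w => w.1

/-- The pair of the exponent vector and the `t`-degree of the image of a monomial of `T`. -/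
def presExp : (Fin n ⊕ ReesGen I →₀ ℕ) →ₗ[ℕ] (Fin n →₀ ℕ) × ℕ :=
  Finsupp.linearCombination ℕ (Sum.elim (fun i => (Finsupp.single i 1, 0)) fun w => w.1)

variable {I}

theorem presExp_eq (m : Fin n ⊕ ReesGen I →₀ ℕ) :
    presExp I m = (xPart m, 0) + genExp I (yPart m) := by
  induction m using Finsupp.induction_linear with
  | zero => simp [Prod.ext_iff]
  | add f g hf hg =>
    rw [map_add, hf, hg, xPart_add, yPart_add, map_add]
    ext <;> simp; ring
  | single i k =>
    rcases i with i | w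
    · simp [presExp]
    · simp [presExp, genExp]

theorem presMap_monomial (m : Fin n ⊕ ReesGen I →₀ ℕ) (c : K) :
    (presMap I (monomial m c) : Polynomial (MvPolynomial (Fin n) K))
      = Polynomial.monomial (presExp I m).2 (monomial (presExp I m).1 c) := by
  have h1 : (presMap I (monomial m 1) : Polynomial (MvPolynomial (Fin n) K))
      = Polynomial.monomial (presExp I m).2 (monomial (presExp I m).1 1) := by
    induction m using Finsupp.induction_linear with
    | zero => simp
    | add f g hf hg =>
      have : monomial (f + g) (1 : K) = monomial f 1 * monomial g 1 := by simp
      rw [this, map_mul, MulMemClass.coe_mul, hf, hg, Polynomial.monomial_mul_monomial,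
        monomial_mul, map_add, one_mul, Prod.fst_add, Prod.snd_add]
    | single i k =>
      rw [← X_pow_eq_monomial, map_pow, SubmonoidClass.coe_pow, presExp,
        Finsupp.linearCombination_single, presMap, aeval_X]
      rcases i with i | w
      · have : ((algebraMap (MvPolynomial (Fin n) K) (symbolicRees I) (X i) : symbolicRees I) :
            Polynomial (MvPolynomial (Fin n) K)) = Polynomial.C (X i) := rfl
        simp only [Sum.elim_inl, this]
        simp [← X_pow_eq_monomial]
      · simp [Polynomial.monomial_pow, monomial_pow, mul_comm]
  have : monomial m c = c • monomial m (1 : K) := by simp [smul_monomial]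
  rw [this, map_smul, Subalgebra.coe_smul, h1]
  simp [Polynomial.smul_monomial, smul_monomial]

/-- The presentation map sends monomials to monomials, so each coefficient of an image collects the
coefficients over one fibre of `presExp`. -/
theorem coeff_coeff_presMap (f : PresRing I) (p : (Fin n →₀ ℕ) × ℕ) :
    coeff p.1 ((presMap I f : Polynomial (MvPolynomial (Fin n) K)).coeff p.2)
      = ∑ m ∈ f.support with presExp I m = p, coeff m f := by
  classical
  conv_lhs => rw [f.as_sum]
  rw [map_sum, AddSubmonoidClass.coe_finsetSum, Polynomial.finsetSum_coeff, coeff_sum,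
    Finset.sum_filter]
  refine Finset.sum_congr rfl fun m _ => ?_
  rw [presMap_monomial, Polynomial.coeff_monomial]
  split_ifs with h1 h2 h2
  · simp [h2]
  · rw [coeff_monomial, if_neg]
    exact fun h => h2 (Prod.ext h h1)
  · exact absurd (congrArg Prod.snd h2) h1
  · simp

theorem orderTLT_irrefl (m : Fin n ⊕ ReesGen I →₀ ℕ) : ¬ OrderTLT I m m := by
  rintro (h | ⟨-, i, -, h⟩)
  · exact RevLexLT.irrefl _ _ h
  · exact lt_irrefl _ h

theorem OrderTLT.add_right {m m' : Fin n ⊕ ReesGen I →₀ ℕ} (h : OrderTLT I m m')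
    (e : Fin n ⊕ ReesGen I →₀ ℕ) : OrderTLT I (m + e) (m' + e) := by
  rcases h with h | ⟨h, h'⟩
  · left
    rw [yPart_add, yPart_add]
    exact h.add_right _
  · right
    rw [yPart_add, yPart_add, xPart_add, xPart_add, h]
    exact ⟨rfl, h'.add_right _⟩

/-- The coefficients of an element of `J` sum to zero over each fibre, so its initial monomial
shares its fibre with another, smaller monomial of the support. -/
theorem exists_orderTLT_of_mem_initialIdeal {m : Fin n ⊕ ReesGen I →₀ ℕ}
    (hm : monomial m (1 : K) ∈ initialIdeal (OrderTLT I) (definingIdeal I)) :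
    ∃ m', presExp I m' = presExp I m ∧ OrderTLT I m' m := by
  classical
  have hset : {u : PresRing I | ∃ f ∈ definingIdeal I, ∃ m, IsInitialMonomial (OrderTLT I) f m ∧
      u = monomial m 1} = (fun m => monomial m (1 : K)) ''
        {m | ∃ f ∈ definingIdeal I, IsInitialMonomial (OrderTLT I) f m} := by
    ext u
    constructor
    · rintro ⟨f, hf, m, hm, rfl⟩
      exact ⟨m, ⟨f, hf, hm⟩, rfl⟩
    · rintro ⟨m, ⟨f, hf, hm⟩, rfl⟩
      exact ⟨f, hf, m, hm, rfl⟩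
  rw [initialIdeal, hset, mem_ideal_span_monomial_image] at hm
  obtain ⟨m₀, ⟨f, hf, hm₀, hlt⟩, hle⟩ := hm m (by simp [support_monomial])
  obtain ⟨e, rfl⟩ := exists_add_of_le hle
  obtain ⟨m', hm', hne, heq⟩ : ∃ m' ∈ f.support, m' ≠ m₀ ∧ presExp I m' = presExp I m₀ := by
    by_contra! hall
    have h0 := coeff_coeff_presMap f (presExp I m₀)
    have hf0 : presMap I f = 0 := hf
    have hs : f.support.filter (fun m => presExp I m = presExp I m₀) = {m₀} := by
      ext m
      rw [Finset.mem_filter, Finset.mem_singleton]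
      constructor
      · rintro ⟨h1, h2⟩
        by_contra h3
        exact hall m h1 h3 h2
      · rintro rfl
        exact ⟨hm₀, rfl⟩
    rw [hf0, hs, Finset.sum_singleton] at h0
    exact mem_support_iff.mp hm₀ (by simpa using h0.symm)
  exact ⟨m' + e, by rw [map_add, map_add, heq], (hlt m' hm' hne).add_right e⟩

/-- The binomial formed by the two monomials lies in `J`. -/
theorem mem_initialIdeal_of_orderTLT {m m' : Fin n ⊕ ReesGen I →₀ ℕ}
    (heq : presExp I m' = presExp I m) (hlt : OrderTLT I m' m) :
    monomial m (1 : K) ∈ initialIdeal (OrderTLT I) (definingIdeal I) := by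
  classical
  have hne : m' ≠ m := by
    rintro rfl
    exact orderTLT_irrefl _ hlt
  refine Ideal.subset_span ⟨monomial m 1 - monomial m' 1, ?_, m, ⟨?_, ?_⟩, rfl⟩
  · rw [definingIdeal, RingHom.mem_ker, map_sub, sub_eq_zero]
    apply Subtype.ext
    rw [presMap_monomial, presMap_monomial, heq]
  · simp [mem_support_iff, coeff_monomial, hne]
  · intro m'' hm'' hne'
    have : m'' = m' := by
      by_contra h
      rw [mem_support_iff, coeff_sub, coeff_monomial, coeff_monomial, if_neg hne'.symm,
        if_neg (Ne.symm h)] at hm''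
      simp at hm''
    rwa [this]

end Presentation

theorem exists_eq_single_of_degree_eq_one {σ : Type*} {a : σ →₀ ℕ} (h : a.degree = 1) :
    ∃ s, a = Finsupp.single s 1 := by
  obtain ⟨s, hs⟩ : ∃ s, a s ≠ 0 := by
    by_contra! h0
    rw [show a = 0 from Finsupp.ext h0, map_zero] at h
    exact zero_ne_one h
  obtain ⟨e, he⟩ := exists_add_of_le
    (Finsupp.single_le_iff.mpr (Nat.one_le_iff_ne_zero.mpr hs) : Finsupp.single s 1 ≤ a)
  have he0 : e.degree = 0 := by
    rw [he, map_add, Finsupp.degree_single] at h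
    omega
  exact ⟨s, by rw [he, (Finsupp.degree_eq_zero_iff e).mp he0, add_zero]⟩

/-! ### The exchange property from the `x`-condition -/

section Exchange

variable {K : Type*} [Field K] {n : ℕ} {I : Ideal (MvPolynomial (Fin n) K)}

theorem monomial_genExp_mem (c : ReesGen I →₀ ℕ) :
    monomial (genExp I c).1 (1 : K) ∈ symbolicPower I (genExp I c).2 := by
  have hmul : ∀ p q : (Fin n →₀ ℕ) × ℕ, monomial p.1 (1 : K) ∈ symbolicPower I p.2 →
      monomial q.1 (1 : K) ∈ symbolicPower I q.2 →
      monomial (p + q).1 (1 : K) ∈ symbolicPower I (p + q).2 := by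
    intro p q hp hq
    simpa using mul_mem_symbolicPower hp hq
  have h0 : monomial (0 : (Fin n →₀ ℕ) × ℕ).1 (1 : K)
      ∈ symbolicPower I (0 : (Fin n →₀ ℕ) × ℕ).2 := by
    simp [symbolicPower_zero]
  induction c using Finsupp.induction_linear with
  | zero => rw [map_zero]; exact h0
  | add f g hf hg =>
    rw [map_add]
    exact hmul _ _ hf hg
  | single w k =>
    rw [genExp, Finsupp.linearCombination_single]
    induction k with
    | zero => rw [zero_smul]; exact h0
    | succ k ih =>
      rw [succ_nsmul]
      exact hmul _ _ ih w.2.2.1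

theorem exists_add_genExp_eq {a : Fin n →₀ ℕ} {k : ℕ}
    (ha : monomial a (1 : K) ∈ symbolicPower I k) :
    ∃ b c, (a, k) = ((b, 0) : (Fin n →₀ ℕ) × ℕ) + genExp I c := by
  induction hN : a.degree + k using Nat.strong_induction_on generalizing a k with
  | _ N ih =>
    rcases Nat.eq_zero_or_pos k with rfl | hk
    · exact ⟨a, 0, by simp⟩
    by_cases hind : IsIndecomposable {q | monomial q.1 (1 : K) ∈ symbolicPower I q.2} (a, k)
    · exact ⟨0, Finsupp.single ⟨(a, k), hk, hind⟩ 1, by simp [genExp]⟩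
    · have hne : ((a, k) : (Fin n →₀ ℕ) × ℕ) ≠ 0 := fun h => hk.ne' (congrArg Prod.snd h)
      simp only [IsIndecomposable, not_and, not_forall, not_or] at hind
      obtain ⟨q, hq, r, hr, hqr, hq0, hr0⟩ := hind ha hne
      have hpos : ∀ p : (Fin n →₀ ℕ) × ℕ, p ≠ 0 → 0 < p.1.degree + p.2 := by
        intro p hp
        rw [Nat.pos_iff_ne_zero]
        intro h0
        rw [Nat.add_eq_zero_iff, Finsupp.degree_eq_zero_iff] at h0
        exact hp (Prod.ext h0.1 h0.2)
      have hsum : N = (q.1.degree + q.2) + (r.1.degree + r.2) := by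
        have h1 : a = q.1 + r.1 := congrArg Prod.fst hqr
        have h2 : k = q.2 + r.2 := congrArg Prod.snd hqr
        rw [← hN, h1, h2, map_add]
        ring
      have hq1 := hpos q hq0
      have hr1 := hpos r hr0
      obtain ⟨b, c, h1⟩ := ih _ (by omega) (a := q.1) (k := q.2) hq rfl
      obtain ⟨b', c', h2⟩ := ih _ (by omega) (a := r.1) (k := r.2) hr rfl
      refine ⟨b + b', c + c', ?_⟩
      have h1' : q = (b, 0) + genExp I c := h1
      have h2' : r = (b', 0) + genExp I c' := h2
      have h3 : ((b + b', 0) : (Fin n →₀ ℕ) × ℕ) = (b, 0) + (b', 0) := by simp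
      rw [hqr, h1', h2', map_add, h3]
      abel

/-- Each generator has `t`-degree at least one, which bounds its multiplicity by `p.2`, and only the
finitely many generators below `p` can occur. -/
theorem finite_genExp_fiber (p : (Fin n →₀ ℕ) × ℕ) : {c | genExp I c = p}.Finite := by
  classical
  have hW : {w : ReesGen I | w.1 ≤ p}.Finite :=
    Set.Finite.preimage Subtype.val_injective.injOn (Set.finite_Iic p)
  refine (Set.finite_Iic (Finsupp.indicator hW.toFinset fun _ _ => p.2)).subset ?_
  intro c hc w
  by_cases hw : c w = 0
  · rw [hw]; exact Nat.zero_le _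
  have hle : c w • w.1 ≤ p := by
    rw [← Set.mem_ofPred.mp hc, ← Finsupp.single_add_erase w c, map_add, genExp,
      Finsupp.linearCombination_single]
    simp only [Finsupp.single_add_erase]
    exact le_self_add
  have hw1 : w.1 ≤ p := le_trans (by
    conv_lhs => rw [← one_smul ℕ w.1]
    exact nsmul_le_nsmul_left zero_le (Nat.one_le_iff_ne_zero.mpr hw)) hle
  rw [Finsupp.indicator_of_mem (by simpa using hw1)]
  calc c w ≤ c w * w.1.2 := Nat.le_mul_of_pos_right _ w.2.1
    _ ≤ p.2 := hle.2

theorem degree_genExp {C d : ℕ} (hdeg : ∀ w : ReesGen I, w.1.1.degree = C * w.1.2 + d)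
    (c : ReesGen I →₀ ℕ) : (genExp I c).1.degree = C * (genExp I c).2 + d * c.degree := by
  induction c using Finsupp.induction_linear with
  | zero => simp
  | add f g hf hg =>
    rw [map_add, Prod.fst_add, map_add, hf, hg, map_add, Prod.snd_add]
    ring
  | single w k =>
    rw [genExp, Finsupp.linearCombination_single, Prod.smul_fst, map_nsmul, hdeg,
      Finsupp.degree_single, Prod.smul_snd]
    simp only [smul_eq_mul]
    ring

/-- The monomial `x^p y^c` is not the smallest in its fibre, and the `x`-condition localizes the
failure to a single variable of `x^p`. -/
theorem exists_exchange_of_xCondition (hx : XCondition I (OrderTLT I)) {k : ℕ}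
    {u u' p : Fin n →₀ ℕ} {c c' : ReesGen I →₀ ℕ} (hu : u ∈ minGens (symbolicPower I k))
    (hc : genExp I c = (u, k)) (hmin : ∀ c'', genExp I c'' = (u, k) → ¬ RevLexLT GenLT c'' c)
    (hc' : genExp I c' = (u', k)) (hlt : RevLexLT GenLT c' c) (hle : u' ≤ p + u) :
    ∃ s, p s ≠ 0 ∧ ∃ b c'', RevLexLT GenLT c'' c ∧
      (Finsupp.single s 1 + u, k) = ((b, 0) : (Fin n →₀ ℕ) × ℕ) + genExp I c'' := by
  obtain ⟨p', hp'⟩ := exists_add_of_le hle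
  have hmem : monomial (p.sumElim c) (1 : K) ∈ initialIdeal (OrderTLT I) (definingIdeal I) := by
    refine mem_initialIdeal_of_orderTLT (m' := p'.sumElim c') ?_ (Or.inl (by simpa using hlt))
    simp [presExp_eq, hc, hc', hp', add_comm p']
  obtain ⟨m₀, hm₀, hm₀le⟩ := exists_mem_minGens_le hmem
  have hdeg := hx m₀ hm₀
  obtain ⟨m₁, heq, hlt₁⟩ := exists_orderTLT_of_mem_initialIdeal hm₀.1
  rw [presExp_eq, presExp_eq] at heq
  have hxle := xPart_mono hm₀le
  have hyle := yPart_mono hm₀le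
  rw [xPart_sumElim] at hxle
  rw [yPart_sumElim] at hyle
  -- The descent is strict already in the `y`-parts: equal `y`-parts with equal images would force
  -- equal `x`-parts.
  have hylt : RevLexLT GenLT (yPart m₁) (yPart m₀) := by
    rcases hlt₁ with h | ⟨h1, h2⟩
    · exact h
    · rw [h1] at heq
      have h3 := congrArg Prod.fst (add_right_cancel heq)
      simp only at h3
      obtain ⟨i, -, hi⟩ := h2
      rw [h3] at hi
      exact absurd hi (lt_irrefl _)
  obtain ⟨e, he⟩ := exists_add_of_le hyle
  have hlt₂ : RevLexLT GenLT (yPart m₁ + e) c := by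
    rw [he]
    exact hylt.add_right e
  have hexp : ((xPart m₁, 0) : (Fin n →₀ ℕ) × ℕ) + genExp I (yPart m₁ + e)
      = (xPart m₀ + u, k) := by
    rw [map_add, ← add_assoc, heq, add_assoc, ← map_add, ← he, hc]
    simp
  rcases Nat.le_one_iff_eq_zero_or_eq_one.mp hdeg with h0 | h1
  -- Without an `x`-variable the smaller monomial would be a presentation of `u` itself: minimality
  -- of `u` removes its `x`-part, contradicting the choice of `c`.
  · exfalso
    rw [Finsupp.degree_eq_zero_iff] at h0
    rw [h0, zero_add] at hexp
    have h2 := monomial_genExp_mem (yPart m₁ + e)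
    have hk : (genExp I (yPart m₁ + e)).2 = k := by simpa using congrArg Prod.snd hexp
    have hu' : xPart m₁ + (genExp I (yPart m₁ + e)).1 = u := congrArg Prod.fst hexp
    rw [hk] at h2
    have h3 := hu.2 _ (hu' ▸ le_add_self) h2
    exact hmin _ (Prod.ext h3 hk) hlt₂
  · obtain ⟨s, hs⟩ := exists_eq_single_of_degree_eq_one h1
    refine ⟨s, ?_, xPart m₁, yPart m₁ + e, hlt₂, ?_⟩
    · have := hxle s
      rw [hs, Finsupp.single_eq_same] at this
      omega
    · rw [hexp, hs]

end Exchange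

/-- The monomials `x ^ u i`, in the given order, have linear quotients, generated by the variables
`x_s` with `s ∈ V i`. -/
def MonomialQuotients {β : Type*} [LT β] {n : ℕ} (u : β → Fin n →₀ ℕ) (V : β → Finset (Fin n)) :
    Prop :=
  ∀ i p, (∃ j < i, u j ≤ p + u i) ↔ ∃ s ∈ V i, p s ≠ 0

/-! ### Linear quotients of symbolic powers -/

section Quotients

variable {K : Type*} [Field K] {n : ℕ} {I : Ideal (MvPolynomial (Fin n) K)}

theorem HasLinearCoverFunction.exists_degree_eq (hcov : HasLinearCoverFunction I)
    (hmin : IsMinimalIntersectionType I) :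
    ∃ C d : ℕ, ∀ w : ReesGen I, w.1.1.degree = C * w.1.2 + d := by
  obtain ⟨C, d, h⟩ := hcov
  refine ⟨C, d, fun w => ?_⟩
  have hset : {q : (Fin n →₀ ℕ) × ℕ | monomial q.1 (1 : K) ∈ symbolicPower I q.2}
      = {p | IsCover (facets I) (weight I) p.2 p.1} := by
    ext q
    exact hmin.monomial_mem_symbolicPower_iff q.2 q.1
  have hw := w.2.2
  have hw' : IsIndecomposable {p | IsCover (facets I) (weight I) p.2 p.1} (w.1.1, w.1.2) :=
    hset ▸ hw
  rw [Finsupp.degree_eq_sum, h w.1.2 w.1.1 w.2.1 hw']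

theorem exists_monomialQuotients (hmin : IsMinimalIntersectionType I)
    (hcov : HasLinearCoverFunction I) (hx : XCondition I (OrderTLT I)) (k : ℕ) :
    ∃ (r : ℕ) (u : Fin r → Fin n →₀ ℕ) (V : Fin r → Finset (Fin n)), Function.Injective u ∧
      Set.range u = minGens (symbolicPower I k) ∧ Monotone (fun i => (u i).degree) ∧
      MonomialQuotients u V := by
  classical
  obtain ⟨C, d, hdeg⟩ := hcov.exists_degree_eq hmin
  -- The standard presentations: for each minimal generator, the smallest `y`-monomial mapping to
  -- it. They are in bijection with the minimal generators and carry the order used below.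
  set Std : Set (GenMonomial I) := {c | ∃ a ∈ minGens (symbolicPower I k), genExp I c = (a, k) ∧
    ∀ c'' : GenMonomial I, genExp I c'' = (a, k) → ¬ c'' < c}
  have hex : ∀ a ∈ minGens (symbolicPower I k), ∃ c ∈ Std, genExp I c = (a, k) := by
    intro a ha
    obtain ⟨b, c, hbc⟩ := exists_add_genExp_eq ha.1
    have hk : (genExp I c).2 = k := by simpa using (congrArg Prod.snd hbc).symm
    have ha' : a = b + (genExp I c).1 := congrArg Prod.fst hbc
    have hmem := monomial_genExp_mem c
    rw [hk] at hmem
    -- The `y`-part alone already gives an element of the symbolic power dividing `a`, so minimality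
    -- of `a` leaves no `x`-factor.
    have hc : genExp I c = (a, k) :=
      Prod.ext (ha.2 _ (ha'.symm ▸ le_add_self) hmem) hk
    obtain ⟨c₀, hc₀, hle⟩ := (finite_genExp_fiber (I := I) (a, k)).exists_minimal
      (α := GenMonomial I) ⟨c, hc⟩
    exact ⟨c₀, ⟨a, ha, hc₀, fun c'' hc'' hlt => absurd (hle hc'' hlt.le) (not_le.mpr hlt)⟩, hc₀⟩
  have huniq : ∀ c ∈ Std, ∀ c' ∈ Std, genExp I c = genExp I c' → c = c' := by
    rintro c ⟨a, -, hca, hc⟩ c' ⟨a', -, hca', hc'⟩ h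
    rcases lt_trichotomy c c' with hlt | heq | hlt
    · exact absurd hlt (hc' c (h.trans hca'))
    · exact heq
    · exact absurd hlt (hc c' (h.symm.trans hca))
  have hfin : Std.Finite := by
    refine Set.Finite.of_finite_image (f := fun c => (genExp I c).1)
      ((finite_minGens (symbolicPower I k)).subset ?_) ?_
    · rintro _ ⟨c, ⟨a, ha, hca, -⟩, rfl⟩
      simpa only [hca] using ha
    · intro c hc c' hc' h
      refine huniq c hc c' hc' (Prod.ext h ?_)
      obtain ⟨a, -, hca, -⟩ := hc
      obtain ⟨a', -, hca', -⟩ := hc'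
      rw [hca, hca']
  set ι := hfin.toFinset.orderIsoOfFin rfl
  have hmemι : ∀ i, (ι i).1 ∈ Std := fun i => hfin.mem_toFinset.mp (ι i).2
  set u : Fin hfin.toFinset.card → Fin n →₀ ℕ := fun i => (genExp I (ι i).1).1 with hu
  have hgen : ∀ i, genExp I (ι i).1 = (u i, k) := by
    intro i
    obtain ⟨a, -, hca, -⟩ := hmemι i
    exact Prod.ext rfl (by rw [hca])
  have hmemu : ∀ i, u i ∈ minGens (symbolicPower I k) := by
    intro i
    obtain ⟨a, ha, hca, -⟩ := hmemι i
    rw [hgen i] at hca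
    rwa [(Prod.mk.inj hca).1]
  have hminι : ∀ i (c : GenMonomial I), genExp I c = (u i, k) → ¬ c < (ι i).1 := by
    intro i c hc
    obtain ⟨a, ha, hca, h⟩ := hmemι i
    rw [hgen i] at hca
    exact h c (hc.trans hca)
  have hsurj : ∀ a ∈ minGens (symbolicPower I k), ∃ i, u i = a := by
    intro a ha
    obtain ⟨c, hc, hca⟩ := hex a ha
    refine ⟨ι.symm ⟨c, hfin.mem_toFinset.mpr hc⟩, ?_⟩
    simp only [hu, OrderIso.apply_symm_apply, hca]
  have hdegu : ∀ i, (u i).degree = C * k + d * (Finsupp.degree : (ReesGen I →₀ ℕ) →+ ℕ) (ι i).1 := by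
    intro i
    have := degree_genExp hdeg (ι i).1
    rwa [hgen i] at this
  refine ⟨_, u, fun i => Finset.univ.filter fun s => ∃ j < i, u j ≤ Finsupp.single s 1 + u i,
    ?_, ?_, ?_, ?_⟩
  · intro i j hij
    exact ι.injective (Subtype.ext (huniq _ (hmemι i) _ (hmemι j) (by rw [hgen, hgen, hij])))
  · ext a
    exact ⟨by rintro ⟨i, rfl⟩; exact hmemu i, fun ha => hsurj a ha⟩
  · intro i j hij
    simp only [hdegu]
    have : (Finsupp.degree : (ReesGen I →₀ ℕ) →+ ℕ) (ι i).1 ≤ (Finsupp.degree : (ReesGen I →₀ ℕ) →+ ℕ) (ι j).1 := by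
      rcases (ι.monotone hij).lt_or_eq with h | h
      · rcases (genMonomial_lt_iff _ _).mp h with h | h
        · exact h.le
        · exact h.1.le
      · rw [h]
    gcongr
  · intro i p
    constructor
    · rintro ⟨j, hji, hle⟩
      obtain ⟨s, hs, b, c'', hlt, heq⟩ := exists_exchange_of_xCondition hx (hmemu i) (hgen i)
        (hminι i) (hgen j) ((genMonomial_lt_iff _ _).mp (ι.strictMono hji)) hle
      refine ⟨s, Finset.mem_filter.mpr ⟨Finset.mem_univ _, ?_⟩, hs⟩
      have hk : (genExp I c'').2 = k := by simpa using (congrArg Prod.snd heq).symm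
      have hfst : Finsupp.single s 1 + u i = b + (genExp I c'').1 := congrArg Prod.fst heq
      have hmem := monomial_genExp_mem c''
      rw [hk] at hmem
      obtain ⟨a, ha, hac⟩ := exists_mem_minGens_le hmem
      obtain ⟨l, rfl⟩ := hsurj a ha
      refine ⟨l, ?_, hac.trans (hfst ▸ le_add_self)⟩
      rw [← ι.lt_iff_lt]
      change (ι l).1 < (ι i).1
      -- If `u l` equals the image of `c''`, its standard presentation is at most `c''`. Otherwise
      -- `u l` has smaller degree, and the linear cover function turns this into fewer `y`-factors,
      -- which the degree-first order detects.
      by_cases heq' : u l = (genExp I c'').1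
      · exact lt_of_le_of_lt (not_lt.mp (hminι l c'' (Prod.ext heq'.symm hk)))
          ((genMonomial_lt_iff (I := I) c'' _).mpr hlt)
      · have hdlt : (u l).degree < (genExp I c'').1.degree := by
          obtain ⟨e, he⟩ := exists_add_of_le hac
          have he0 : e ≠ 0 := by
            rintro rfl
            exact heq' (by rw [he, add_zero])
          rw [he, map_add]
          have := mt (Finsupp.degree_eq_zero_iff e).mp he0
          omega
        rw [hdegu, degree_genExp hdeg, hk] at hdlt
        have hdlt' := Nat.lt_of_mul_lt_mul_left (Nat.lt_of_add_lt_add_left hdlt)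
        refine lt_trans ((genMonomial_lt_iff (I := I) _ c'').mpr (Or.inl hdlt'))
          ((genMonomial_lt_iff (I := I) c'' _).mpr hlt)
    · rintro ⟨s, hs, hps⟩
      obtain ⟨-, j, hji, hle⟩ := Finset.mem_filter.mp hs
      refine ⟨j, hji, hle.trans ?_⟩
      gcongr
      rw [Finsupp.single_le_iff]
      omega

end Quotients

/-! ### From exponent vectors to colon ideals -/

section MonomialIdeal

variable {K : Type*} [Field K] {n : ℕ}

theorem forall_mem_support_mul_monomial {σ : Type*} (f : MvPolynomial σ K) (b : σ →₀ ℕ)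
    (P : (σ →₀ ℕ) → Prop) :
    (∀ a ∈ (f * monomial b 1).support, P a) ↔ ∀ a ∈ f.support, P (a + b) := by
  constructor
  · intro h a ha
    refine h _ (mem_support_iff.mpr ?_)
    rw [coeff_mul_monomial, mul_one]
    exact mem_support_iff.mp ha
  · intro h a ha
    rw [mem_support_iff, coeff_mul_monomial'] at ha
    split_ifs at ha with hle
    · rw [mul_one] at ha
      simpa [tsub_add_cancel_of_le hle] using h _ (mem_support_iff.mpr ha)
    · exact absurd rfl ha

theorem mem_span_monomial_image_iff {β : Type*} (u : β → Fin n →₀ ℕ) (S : Set β)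
    (f : MvPolynomial (Fin n) K) :
    f ∈ Ideal.span ((fun j => monomial (u j) (1 : K)) '' S) ↔
      ∀ a ∈ f.support, ∃ j ∈ S, u j ≤ a := by
  have h : (fun j => monomial (u j) (1 : K)) '' S = (fun a => monomial a (1 : K)) '' (u '' S) := by
    rw [Set.image_image]
  rw [h, mem_ideal_span_monomial_image]
  simp

theorem MonomialQuotients.mul_monomial_mem_span_iff {β : Type*} [LT β] {u : β → Fin n →₀ ℕ}
    {V : β → Finset (Fin n)} (h : MonomialQuotients u V) (i : β) (f : MvPolynomial (Fin n) K) :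
    f * monomial (u i) 1 ∈ Ideal.span ((fun j => monomial (u j) (1 : K)) '' {j | j < i}) ↔
      f ∈ varIdeal K (V i) := by
  rw [mem_span_monomial_image_iff, mem_varIdeal_iff, forall_mem_support_mul_monomial]
  exact forall₂_congr fun a _ => h i a

theorem isMonomialIdeal_of_mem_iff {J : Ideal (MvPolynomial (Fin n) K)}
    (hJ : ∀ f, f ∈ J ↔ ∀ a ∈ f.support, monomial a (1 : K) ∈ J) : IsMonomialIdeal J := by
  refine ⟨minGens J, ?_⟩
  ext f
  rw [hJ, mem_ideal_span_monomial_image]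
  exact forall₂_congr fun a _ =>
    ⟨exists_mem_minGens_le, fun ⟨b, hb, hba⟩ => monomial_mem_of_le hba hb.1⟩

theorem MonomialQuotients.hasLinearQuotients {J : Ideal (MvPolynomial (Fin n) K)}
    (hJ : ∀ f, f ∈ J ↔ ∀ a ∈ f.support, monomial a (1 : K) ∈ J) {r : ℕ}
    {u : Fin r → Fin n →₀ ℕ} {V : Fin r → Finset (Fin n)} (hinj : Function.Injective u)
    (hrange : Set.range u = minGens J) (h : MonomialQuotients u V) : HasLinearQuotients J := by
  refine ⟨isMonomialIdeal_of_mem_iff hJ, r, u, hinj, hrange, fun i => ⟨V i, ?_⟩⟩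
  ext f
  rw [Submodule.mem_colon_singleton, smul_eq_mul, h.mul_monomial_mem_span_iff]

end MonomialIdeal

/-! ### Linear quotients of degree components -/

section DegreePart

variable {n : ℕ}

theorem eq_of_le_of_degree_le {a b : Fin n →₀ ℕ} (h : a ≤ b) (hd : b.degree ≤ a.degree) :
    a = b := by
  obtain ⟨e, rfl⟩ := exists_add_of_le h
  have : e.degree = 0 := by
    rw [map_add] at hd
    omega
  rw [(Finsupp.degree_eq_zero_iff e).mp this, add_zero]

/-- If `p < q` lexicographically and `deg q ≤ deg p`, then `p t < q t` for the first index with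
different exponents, and some later exponent of `p` is larger than that of `q`. -/
theorem exists_lt_of_toLex_lt {p q : Fin n →₀ ℕ} (h : toLex p < toLex q)
    (hd : q.degree ≤ p.degree) : ∃ t s, t < s ∧ q t ≠ 0 ∧ q s < p s := by
  obtain ⟨t, ht, hlt⟩ := (lexLT_iff p q).mpr h
  by_contra! hall
  have hle : ∀ s, p s ≤ q s := by
    intro s
    rcases lt_trichotomy s t with hs | rfl | hs
    · exact (ht s hs).le
    · exact hlt.le
    · exact hall t s hs (by omega)
  have := eq_of_le_of_degree_le hle hd
  rw [this] at hlt
  exact lt_irrefl _ hlt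

/-- Each monomial of degree `d` in the ideal is written `u_i x^e` with `e` avoiding `V i`. These are
ordered by `i`, then lexicographically by `e`; besides `V i`, the colon ideal gains the variables
`x_s` for which `x^e` involves some `x_t` with `t < s`. -/
theorem MonomialQuotients.exists_degreePart {r : ℕ} {u : Fin r → Fin n →₀ ℕ}
    {V : Fin r → Finset (Fin n)} (h : MonomialQuotients u V)
    (hmono : Monotone fun i => (u i).degree) (d : ℕ) :
    ∃ (β : Type) (_ : Fintype β) (_ : LinearOrder β) (u' : β → Fin n →₀ ℕ)
      (V' : β → Finset (Fin n)), MonomialQuotients u' V' ∧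
      Set.range u' = {a | a.degree = d ∧ ∃ i, u i ≤ a} := by
  classical
  let β : Type := {p : Fin r ×ₗ Lex (Fin n →₀ ℕ) // (u (ofLex p).1).degree +
    (ofLex (ofLex p).2).degree = d ∧ ∀ s ∈ V (ofLex p).1, ofLex (ofLex p).2 s = 0}
  let idx : β → Fin r := fun p => (ofLex p.1).1
  let q : β → Fin n →₀ ℕ := fun p => ofLex (ofLex p.1).2
  let mk : ∀ (i : Fin r) (e : Fin n →₀ ℕ), (u i).degree + e.degree = d → (∀ s ∈ V i, e s = 0) → β :=
    fun i e h1 h2 => ⟨toLex (i, toLex e), h1, h2⟩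
  have hdeg : ∀ p : β, (u (idx p)).degree + (q p).degree = d := fun p => p.2.1
  have hV : ∀ p : β, ∀ s ∈ V (idx p), q p s = 0 := fun p => p.2.2
  have hlt : ∀ p p' : β, p < p' ↔ idx p < idx p' ∨ idx p = idx p' ∧ toLex (q p) < toLex (q p') :=
    fun _ _ => Prod.Lex.lt_iff
  have hfin : Finite β := by
    have : Finite {e : Fin n →₀ ℕ | e.degree ≤ d} := Finsupp.finite_of_degree_le d
    refine Finite.of_injective
      (fun p : β => ((idx p, ⟨q p, by have := hdeg p; exact Set.mem_ofPred.mpr (by omega)⟩) :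
        Fin r × {e : Fin n →₀ ℕ | e.degree ≤ d})) ?_
    intro p p' hpp
    rw [Prod.mk.injEq, Subtype.mk.injEq] at hpp
    exact Subtype.ext (ofLex.injective (Prod.ext hpp.1 (ofLex.injective hpp.2)))
  -- every multiple of degree `d` of some `u j` is of the form `u l + e` with `l ≤ j`
  have hrep : ∀ j (a : Fin n →₀ ℕ), u j ≤ a → a.degree = d →
      ∃ p : β, idx p ≤ j ∧ u (idx p) + q p = a := by
    intro j
    induction j using WellFoundedLT.induction with
    | _ j ih =>
      intro a hja had
      obtain ⟨e, rfl⟩ := exists_add_of_le hja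
      by_cases he : ∃ s ∈ V j, e s ≠ 0
      · obtain ⟨l, hlj, hl⟩ := (h j e).mpr he
        rw [add_comm] at hl
        obtain ⟨p, hp, hpa⟩ := ih l hlj _ hl had
        exact ⟨p, hp.trans hlj.le, hpa⟩
      · push Not at he
        exact ⟨mk j e (by rw [← had, map_add]) he, le_rfl, rfl⟩
  refine ⟨β, Fintype.ofFinite β, inferInstance, fun p => u (idx p) + q p,
    fun p => V (idx p) ∪ Finset.univ.filter fun s => ∃ t < s, q p t ≠ 0, ?_, ?_⟩
  · intro i p
    constructor
    · rintro ⟨j, hji, hle⟩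
      change u (idx j) + q j ≤ p + (u (idx i) + q i) at hle
      by_contra! hno
      have hpV : ∀ s ∈ V (idx i), p s = 0 := fun s hs =>
        hno s (Finset.mem_union_left _ hs)
      have hpq : ∀ s t, t < s → q i t ≠ 0 → p s = 0 := fun s t hts hq =>
        hno s (Finset.mem_union_right _ (Finset.mem_filter.mpr ⟨Finset.mem_univ _, t, hts, hq⟩))
      rcases (hlt j i).mp hji with hlt' | ⟨heq, hlt'⟩
      · have hle' : u (idx j) ≤ (p + q i) + u (idx i) :=
          le_self_add.trans (hle.trans (by rw [add_comm (u (idx i)), add_assoc]))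
        obtain ⟨s, hs, hne⟩ := (h _ _).mp ⟨_, hlt', hle'⟩
        apply hne
        rw [Finsupp.add_apply, hpV s hs, hV i s hs]
      · have hle' : q j ≤ p + q i := by
          rw [heq, add_left_comm] at hle
          exact le_of_add_le_add_left hle
        have h1 := hdeg i
        have h2 := hdeg j
        rw [heq] at h2
        obtain ⟨t, s, hts, hqt, hs⟩ := exists_lt_of_toLex_lt hlt' (by omega)
        have h3 := hle' s
        rw [Finsupp.add_apply, hpq s t hts hqt] at h3
        omega
    · rintro ⟨s, hs, hps⟩
      have hsp : Finsupp.single s 1 ≤ p := by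
        rw [Finsupp.single_le_iff]
        omega
      suffices ∃ j < i, u (idx j) + q j ≤ Finsupp.single s 1 + (u (idx i) + q i) by
        obtain ⟨j, hj, hle⟩ := this
        exact ⟨j, hj, hle.trans (by gcongr)⟩
      by_cases hsV : s ∈ V (idx i)
      · obtain ⟨l, hl, hle⟩ := (h (idx i) (Finsupp.single s 1)).mpr ⟨s, hsV, by simp⟩
        obtain ⟨e, he⟩ := exists_add_of_le (hle.trans
          (by gcongr; exact le_self_add : _ ≤ Finsupp.single s 1 + (u (idx i) + q i)))
        -- Monotonicity of degrees enters here: the cofactor `e` of `u l` is nontrivial, so one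
        -- variable can be dropped from it to return to degree `d`.
        have hed : e.degree ≠ 0 := by
          have h1 := congrArg Finsupp.degree he
          simp only [map_add, Finsupp.degree_single] at h1
          have h2 : (u l).degree ≤ (u (idx i)).degree := hmono hl.le
          omega
        obtain ⟨t, ht⟩ : ∃ t, e t ≠ 0 := by
          by_contra! h0
          exact hed ((Finsupp.degree_eq_zero_iff e).mpr (Finsupp.ext h0))
        obtain ⟨e', rfl⟩ := exists_add_of_le
          (Finsupp.single_le_iff.mpr (Nat.one_le_iff_ne_zero.mpr ht) : Finsupp.single t 1 ≤ e)
        have hd' : (u l + e').degree = d := by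
          have h1 := congrArg Finsupp.degree he
          simp only [map_add, Finsupp.degree_single] at h1 ⊢
          have := hdeg i
          omega
        obtain ⟨j, hj, hje⟩ := hrep l _ le_self_add hd'
        refine ⟨j, (hlt _ _).mpr (Or.inl (hj.trans_lt hl)), ?_⟩
        rw [hje, he]
        gcongr
        exact le_add_self
      · obtain hs' | hs' := Finset.mem_union.mp hs
        · exact absurd hs' hsV
        obtain ⟨-, t, hts, hqt⟩ := Finset.mem_filter.mp hs'
        obtain ⟨e, he⟩ := exists_add_of_le
          (Finsupp.single_le_iff.mpr (Nat.one_le_iff_ne_zero.mpr hqt) :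
            Finsupp.single t 1 ≤ q i)
        have heV : ∀ x ∈ V (idx i), (Finsupp.single s 1 + e : Fin n →₀ ℕ) x = 0 := by
          intro x hx
          have h1 := hV i x hx
          rw [he, Finsupp.add_apply] at h1
          have hsx : s ≠ x := fun h => hsV (h ▸ hx)
          rw [Finsupp.add_apply, Finsupp.single_eq_of_ne' hsx]
          omega
        have hd' : (u (idx i)).degree + (Finsupp.single s 1 + e).degree = d := by
          have h1 := hdeg i
          rw [he] at h1
          simp only [map_add, Finsupp.degree_single] at h1 ⊢
          omega
        -- Trading `x_t` for the later variable `x_s` gives a lexicographically smaller cofactor,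
        -- still avoiding `V (idx i)` because `s` is not in it.
        refine ⟨mk (idx i) (Finsupp.single s 1 + e) hd' heV, (hlt _ _).mpr (Or.inr ⟨rfl, ?_⟩), ?_⟩
        · refine (lexLT_iff _ _).mp ⟨t, fun x hx => ?_, ?_⟩
          · change (Finsupp.single s 1 + e : Fin n →₀ ℕ) x = q i x
            rw [he]
            simp [hx.ne', (hx.trans hts).ne']
          · change (Finsupp.single s 1 + e : Fin n →₀ ℕ) t < q i t
            rw [he]
            simp [hts.ne']
        · change u (idx i) + (Finsupp.single s 1 + e) ≤ Finsupp.single s 1 + (u (idx i) + q i)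
          rw [he, add_left_comm]
          gcongr
          exact le_add_self
  · ext a
    constructor
    · rintro ⟨p, rfl⟩
      exact ⟨by rw [map_add]; exact hdeg p, idx p, le_self_add⟩
    · rintro ⟨hd, i, hi⟩
      obtain ⟨p, -, hp⟩ := hrep i a hi hd
      exact ⟨p, hp⟩

end DegreePart

section GradedPart

variable {K : Type*} [Field K] {n : ℕ}

theorem gradedPartIdeal_eq_span {J : Ideal (MvPolynomial (Fin n) K)}
    (hJ : ∀ f, f ∈ J ↔ ∀ a ∈ f.support, monomial a (1 : K) ∈ J) {β : Type*}
    {u : β → Fin n →₀ ℕ} {d : ℕ}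
    (hu : Set.range u = {a | a.degree = d ∧ monomial a (1 : K) ∈ J}) :
    Ideal.span (Set.range fun i => monomial (u i) (1 : K)) = gradedPartIdeal J d := by
  apply le_antisymm
  · rw [Ideal.span_le]
    rintro _ ⟨i, rfl⟩
    have hi : u i ∈ {a | a.degree = d ∧ monomial a (1 : K) ∈ J} := hu ▸ Set.mem_range_self i
    exact Ideal.subset_span ⟨hi.2, isHomogeneous_monomial _ hi.1⟩
  · rw [gradedPartIdeal, Ideal.span_le]
    rintro f ⟨hf, hfd⟩
    rw [SetLike.mem_coe, ← Set.image_univ, mem_span_monomial_image_iff]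
    intro a ha
    have hd : a.degree = d := by
      by_contra hne
      exact mem_support_iff.mp ha (hfd.coeff_eq_zero hne)
    have : a ∈ Set.range u := hu ▸ ⟨hd, (hJ f).mp hf a ha⟩
    obtain ⟨i, rfl⟩ := this
    exact ⟨i, Set.mem_univ _, le_rfl⟩

theorem homogeneousComponent_mem_of_mem_iff {J : Ideal (MvPolynomial (Fin n) K)}
    (hJ : ∀ f, f ∈ J ↔ ∀ a ∈ f.support, monomial a (1 : K) ∈ J) {f : MvPolynomial (Fin n) K}
    (hf : f ∈ J) (d : ℕ) : homogeneousComponent d f ∈ J := by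
  rw [hJ] at hf ⊢
  intro a ha
  refine hf a ?_
  rw [mem_support_iff, coeff_homogeneousComponent] at ha
  split_ifs at ha
  · exact mem_support_iff.mpr ha
  · exact absurd rfl ha

end GradedPart

/-! ### Linear syzygies and resolutions -/

section Syzygies

variable {K : Type*} [Field K] {n : ℕ}

/-- The sequence `g` in a module has linear quotients, generated by the variables `x_s` with
`s ∈ V i`. -/
def ModuleQuotients (K : Type*) [Field K] {n : ℕ} {M : Type*} [AddCommGroup M] [Module (MvPolynomial (Fin n) K) M] {β : Type*}
    [LT β] (g : β → M) (V : β → Finset (Fin n)) : Prop :=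
  ∀ i (f : MvPolynomial (Fin n) K),
    f • g i ∈ Submodule.span (MvPolynomial (Fin n) K) (g '' {j | j < i}) ↔ f ∈ varIdeal K (V i)

/-- For every `s ∈ V i` there is a relation `x_s g_i = ∑_{j < i} c_j g_j` with linear forms `c_j`. -/
def HasLinearRelations (K : Type*) [Field K] {n : ℕ} {M : Type*} [AddCommGroup M] [Module (MvPolynomial (Fin n) K) M] {β : Type*}
    [LT β] [Fintype β] (g : β → M) (V : β → Finset (Fin n)) : Prop :=
  ∀ i, ∀ s ∈ V i, ∃ c : β → MvPolynomial (Fin n) K, (∀ j, (c j).IsHomogeneous 1) ∧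
    (∀ j, ¬ j < i → c j = 0) ∧ (X s : MvPolynomial (Fin n) K) • g i = ∑ j, c j • g j

theorem X_mem_varIdeal_iff {s : Fin n} {V : Finset (Fin n)} :
    (X s : MvPolynomial (Fin n) K) ∈ varIdeal K V ↔ s ∈ V := by
  classical
  refine ⟨fun h => ?_, fun h => Ideal.subset_span (Set.mem_image_of_mem _ h)⟩
  obtain ⟨t, ht, hne⟩ := (mem_varIdeal_iff V _).mp h (Finsupp.single s 1) (by simp [support_X])
  rw [Finsupp.single_apply_ne_zero] at hne
  exact hne.1 ▸ ht

theorem homogeneousComponent_mul_of_isHomogeneous {σ R : Type*} [CommSemiring R]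
    (f : MvPolynomial σ R) {g : MvPolynomial σ R} {e : ℕ} (hg : g.IsHomogeneous e) (d : ℕ) :
    homogeneousComponent (d + e) (f * g) = homogeneousComponent d f * g := by
  conv_lhs => rw [← sum_homogeneousComponent f, Finset.sum_mul, map_sum]
  have h : ∀ i, homogeneousComponent (d + e) (homogeneousComponent i f * g)
      = if d = i then homogeneousComponent i f * g else 0 := by
    intro i
    rw [homogeneousComponent_of_mem (n := i + e)
      ((homogeneousComponent_isHomogeneous i f).mul hg)]
    simp only [Nat.add_right_cancel_iff]
  simp only [h, Finset.sum_ite_eq, Finset.mem_range]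
  split_ifs with hd
  · rfl
  · rw [homogeneousComponent_eq_zero _ _ (by omega), zero_mul]

/-- All coordinates of the `g_i` have the same degree `e`, so the component of degree `1 + e` of any
relation for `x_s g_i` retains only the linear parts of its coefficients. -/
theorem ModuleQuotients.hasLinearRelations {β γ : Type*} [LinearOrder β] [Fintype β]
    {g : β → γ → MvPolynomial (Fin n) K} {V : β → Finset (Fin n)} {e : ℕ}
    (hg : ∀ i x, (g i x).IsHomogeneous e) (h : ModuleQuotients K g V) : HasLinearRelations K g V := by
  classical
  intro i s hs
  have hmem := (h i (X s)).mpr (X_mem_varIdeal_iff.mpr hs)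
  have hset : {j | j < i} = ((Finset.univ.filter (· < i) : Finset β) : Set β) := by
    ext; simp
  rw [hset, Submodule.mem_span_image_finset_iff_exists_fun'] at hmem
  obtain ⟨c, hc⟩ := hmem
  refine ⟨fun j => if j < i then homogeneousComponent 1 (c j) else 0, fun j => ?_, fun j hj => ?_,
    ?_⟩
  · dsimp only
    split_ifs
    · exact homogeneousComponent_isHomogeneous _ _
    · exact isHomogeneous_zero _ _ _
  · exact if_neg hj
  · funext x
    have hx := congrArg (homogeneousComponent (1 + e)) (congrFun hc x)
    simp only [Pi.smul_apply, smul_eq_mul, Finset.sum_apply, map_sum,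
      homogeneousComponent_mul_of_isHomogeneous _ (hg _ _)] at hx ⊢
    rw [homogeneousComponent_eq_self (isHomogeneous_X _ _)] at hx
    rw [← hx, Finset.sum_filter]
    exact Finset.sum_congr rfl fun j _ => by split_ifs <;> simp

/-- The linear syzygies of a sequence with linear quotients generate all syzygies, and have linear
quotients again. -/
theorem ModuleQuotients.exists_syzygies {M : Type*} [AddCommGroup M]
    [Module (MvPolynomial (Fin n) K) M] {β : Type} [Fintype β] [LinearOrder β] {g : β → M}
    {V : β → Finset (Fin n)} (hq : ModuleQuotients K g V) (hlin : HasLinearRelations K g V) :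
    ∃ (β' : Type) (_ : Fintype β') (_ : LinearOrder β')
      (A : Matrix β' β (MvPolynomial (Fin n) K)) (V' : β' → Finset (Fin n)),
      (∀ p q, (A p q).IsHomogeneous 1) ∧ ModuleQuotients K (fun p => A p) V' ∧
      ∀ v : β → MvPolynomial (Fin n) K, ∑ j, v j • g j = 0 ↔ ∃ w, v = Matrix.vecMul w A := by
  classical
  -- One syzygy for each pair `(i, s)` with `s ∈ V i`. Its last nonzero coordinate is `x_s`, in
  -- position `i`; rows are ordered by position, then by variable.
  let β' : Type := {p : β ×ₗ Fin n // (ofLex p).2 ∈ V (ofLex p).1}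
  let idx : β' → β := fun p => (ofLex p.1).1
  let var : β' → Fin n := fun p => (ofLex p.1).2
  have hvar : ∀ p : β', var p ∈ V (idx p) := fun p => p.2
  have hlt : ∀ p p' : β', p < p' ↔ idx p < idx p' ∨ idx p = idx p' ∧ var p < var p' :=
    fun _ _ => Prod.Lex.lt_iff
  have : Finite β' := Finite.of_injective (fun p : β' => (idx p, var p)) fun p p' h =>
    Subtype.ext (ofLex.injective h)
  have hfin : Fintype β' := Fintype.ofFinite β'
  choose c hc1 hc0 hc using fun p : β' => hlin (idx p) (var p) (hvar p)
  let A : Matrix β' β (MvPolynomial (Fin n) K) := fun p => Pi.single (idx p) (X (var p)) - c p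
  have hAself : ∀ p, A p (idx p) = X (var p) := fun p => by
    simp [A, hc0 p (idx p) (lt_irrefl _)]
  have hAgt : ∀ p j, idx p < j → A p j = 0 := fun p j hj => by
    simp [A, hc0 p j hj.not_gt, hj.ne']
  let φ : (β → MvPolynomial (Fin n) K) →ₗ[MvPolynomial (Fin n) K] M :=
    Fintype.linearCombination (MvPolynomial (Fin n) K) g
  have hφ : ∀ v, φ v = ∑ j, v j • g j := fun v => Fintype.linearCombination_apply _ _ v
  have hφA : ∀ p, φ (A p) = 0 := by
    intro p
    have h1 : φ (A p) = φ (Pi.single (idx p) (X (var p))) - φ (c p) := map_sub _ _ _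
    rw [h1, hφ (c p), ← hc p, sub_eq_zero]
    exact Fintype.linearCombination_apply_single _ _ _ _
  have hspan : ∀ i v, φ v = 0 → (∀ j, i < j → v j = 0) →
      v ∈ Submodule.span (MvPolynomial (Fin n) K) (A '' {p | idx p ≤ i}) := by
    intro i
    induction i using WellFoundedLT.induction with
    | _ i ih =>
      intro v hv hvi
      -- The relation expresses `v i • g i` through earlier terms, so its leading coefficient lies
      -- in the colon ideal and can be cancelled by rows in position `i`.
      have hmem : v i ∈ varIdeal K (V i) := by
        rw [← hq i, ← neg_mem_iff]
        have h1 : -(v i • g i) = ∑ j ∈ Finset.univ.erase i, v j • g j := by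
          rw [hφ, ← Finset.add_sum_erase _ _ (Finset.mem_univ i)] at hv
          exact neg_eq_of_add_eq_zero_right hv
        rw [h1]
        refine Submodule.sum_mem _ fun j hj => ?_
        rcases lt_or_gt_of_ne (Finset.ne_of_mem_erase hj) with hji | hji
        · exact Submodule.smul_mem _ _ (Submodule.subset_span ⟨j, hji, rfl⟩)
        · rw [hvi j hji, zero_smul]
          exact Submodule.zero_mem _
      obtain ⟨y, hy, hyi, hyj⟩ : ∃ y ∈ Submodule.span (MvPolynomial (Fin n) K)
          (A '' {p | idx p = i}), y i = v i ∧ ∀ j, i < j → y j = 0 := by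
        refine Submodule.span_induction (p := fun f _ => ∃ y ∈ Submodule.span
          (MvPolynomial (Fin n) K) (A '' {p | idx p = i}), y i = f ∧ ∀ j, i < j → y j = 0)
          ?_ ?_ ?_ ?_ hmem
        · rintro _ ⟨s, hs, rfl⟩
          let p : β' := ⟨toLex (i, s), hs⟩
          exact ⟨A p, Submodule.subset_span ⟨p, rfl, rfl⟩, hAself p, fun j hj => hAgt p j hj⟩
        · exact ⟨0, Submodule.zero_mem _, rfl, fun _ _ => rfl⟩
        · rintro f f' - - ⟨y, hy, hyi, hyj⟩ ⟨y', hy', hyi', hyj'⟩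
          exact ⟨y + y', Submodule.add_mem _ hy hy', by simp [hyi, hyi'],
            fun j hj => by simp [hyj j hj, hyj' j hj]⟩
        · rintro a f - ⟨y, hy, hyi, hyj⟩
          exact ⟨a • y, Submodule.smul_mem _ _ hy, by simp [hyi],
            fun j hj => by simp [hyj j hj]⟩
      have hφy : φ y = 0 := by
        have hle : Submodule.span (MvPolynomial (Fin n) K) (A '' {p | idx p = i})
            ≤ LinearMap.ker φ := by
          rw [Submodule.span_le]
          rintro _ ⟨p, -, rfl⟩
          exact hφA p
        exact hle hy
      have hy' : y ∈ Submodule.span (MvPolynomial (Fin n) K) (A '' {p | idx p ≤ i}) :=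
        Submodule.span_mono (Set.image_mono fun p (hp : idx p = i) => hp.le) hy
      rw [← sub_add_cancel v y]
      refine Submodule.add_mem _ ?_ hy'
      by_cases h0 : v - y = 0
      · rw [h0]
        exact Submodule.zero_mem _
      obtain ⟨j₀, hj₀⟩ := Function.ne_iff.mp h0
      obtain ⟨j, hj, hmax⟩ := (Finset.univ.filter fun j => (v - y) j ≠ 0).exists_max_image id
        ⟨j₀, by simpa using hj₀⟩
      have hjne := (Finset.mem_filter.mp hj).2
      have hji : j < i := by
        by_contra hle
        rcases (not_lt.mp hle).eq_or_lt with heq | hgt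
        · subst heq
          exact hjne (by simp [hyi])
        · exact hjne (by simp [hvi j hgt, hyj j hgt])
      refine Submodule.span_mono (Set.image_mono fun p (hp : idx p ≤ j) => hp.trans hji.le)
        (ih j hji (v - y) (by rw [map_sub, hv, hφy, sub_zero]) fun l hl => ?_)
      by_contra hne
      exact absurd (hmax l (Finset.mem_filter.mpr ⟨Finset.mem_univ _, hne⟩)) (not_le.mpr hl)
  have hspan' : ∀ v, φ v = 0 → v ≠ 0 → ∃ j, v j ≠ 0 ∧
      v ∈ Submodule.span (MvPolynomial (Fin n) K) (A '' {p | idx p ≤ j}) := by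
    intro v hv h0
    obtain ⟨j₀, hj₀⟩ := Function.ne_iff.mp h0
    obtain ⟨j, hj, hmax⟩ := (Finset.univ.filter fun j => v j ≠ 0).exists_max_image id
      ⟨j₀, by simpa using hj₀⟩
    refine ⟨j, (Finset.mem_filter.mp hj).2, hspan j v hv fun l hl => ?_⟩
    by_contra hne
    exact absurd (hmax l (Finset.mem_filter.mpr ⟨Finset.mem_univ _, hne⟩)) (not_le.mpr hl)
  refine ⟨β', hfin, inferInstance, A, fun p => (V (idx p)).filter (· < var p), ?_, ?_, ?_⟩
  · intro p j
    refine IsHomogeneous.sub ?_ (hc1 p j)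
    rw [Pi.single_apply]
    split_ifs
    · exact isHomogeneous_X _ _
    · exact isHomogeneous_zero _ _ _
  · intro p f
    constructor
    · intro hf
      -- Read off coordinate `idx p`: rows of earlier position vanish there, the others contribute
      -- variables smaller than `var p`. Primality of the variable ideal then removes the factor
      -- `var p`.
      have hle : Submodule.span (MvPolynomial (Fin n) K) ((fun p => A p) '' {q | q < p}) ≤
          Submodule.comap (LinearMap.proj (idx p))
            (varIdeal K ((V (idx p)).filter (· < var p))) := by
        rw [Submodule.span_le]
        rintro _ ⟨q, hq, rfl⟩
        change A q (idx p) ∈ varIdeal K _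
        rcases (hlt q p).mp hq with h | ⟨h1, h2⟩
        · rw [hAgt q _ h]
          exact Ideal.zero_mem _
        · rw [← h1, hAself, X_mem_varIdeal_iff]
          exact Finset.mem_filter.mpr ⟨hvar q, h2⟩
      have h1 : f * A p (idx p) ∈ varIdeal K ((V (idx p)).filter (· < var p)) := hle hf
      rw [hAself] at h1
      refine ((varIdeal_isPrime _).mem_or_mem h1).resolve_right ?_
      rw [X_mem_varIdeal_iff]
      simp
    · intro hf
      have hle : varIdeal K ((V (idx p)).filter (· < var p)) ≤
          Submodule.comap (LinearMap.toSpanSingleton (MvPolynomial (Fin n) K) _ (A p))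
            (Submodule.span (MvPolynomial (Fin n) K) ((fun p => A p) '' {q | q < p})) := by
        rw [varIdeal, Ideal.span, Submodule.span_le]
        rintro _ ⟨t, ht, rfl⟩
        obtain ⟨htV, htlt⟩ := Finset.mem_filter.mp (Finset.mem_coe.mp ht)
        let q : β' := ⟨toLex (idx p, t), htV⟩
        have hqp : q < p := (hlt q p).mpr (Or.inr ⟨rfl, htlt⟩)
        change (X t : MvPolynomial (Fin n) K) • A p ∈
          Submodule.span (MvPolynomial (Fin n) K) ((fun p => A p) '' {q | q < p})
        -- In `x_t A_p - x_s A_q`, where `s` is `var p`, the leading coordinates cancel, so this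
        -- syzygy is a combination of rows of strictly earlier position.
        rw [← sub_add_cancel ((X t : MvPolynomial (Fin n) K) • A p)
          ((X (var p) : MvPolynomial (Fin n) K) • A q)]
        refine Submodule.add_mem _ ?_
          (Submodule.smul_mem _ _ (Submodule.subset_span ⟨q, hqp, rfl⟩))
        set z := (X t : MvPolynomial (Fin n) K) • A p - (X (var p) : MvPolynomial (Fin n) K) • A q
          with hz
        by_cases h0 : z = 0
        · rw [h0]
          exact Submodule.zero_mem _
        obtain ⟨j, hj, hzj⟩ := hspan' z (by rw [hz, map_sub, map_smul, map_smul, hφA, hφA]; simp) h0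
        have hjp : j < idx p := by
          by_contra hle
          apply hj
          rcases (not_lt.mp hle).eq_or_lt with heq | hgt
          · have h2 : A q (idx p) = X t := hAself q
            rw [← heq, hz, Pi.sub_apply, Pi.smul_apply, Pi.smul_apply, hAself, h2, smul_eq_mul,
              smul_eq_mul]
            ring
          · rw [hz, Pi.sub_apply, Pi.smul_apply, Pi.smul_apply, hAgt p j hgt, hAgt q j hgt]
            simp
        exact Submodule.span_mono (Set.image_mono fun l (hl : idx l ≤ j) =>
          (hlt l p).mpr (Or.inl (hl.trans_lt hjp))) hzj
      exact hle hf
  · intro v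
    rw [← hφ]
    constructor
    · intro hv
      have hmem : v ∈ Submodule.span (MvPolynomial (Fin n) K) (Set.range A) := by
        by_cases h0 : v = 0
        · rw [h0]
          exact Submodule.zero_mem _
        obtain ⟨j, -, hj⟩ := hspan' v hv h0
        exact Submodule.span_mono (Set.image_subset_range _ _) hj
      obtain ⟨w, hw⟩ := (Submodule.mem_span_range_iff_exists_fun _).mp hmem
      exact ⟨w, by rw [Matrix.vecMul_eq_sum, ← hw]⟩
    · rintro ⟨w, rfl⟩
      rw [Matrix.vecMul_eq_sum, map_sum]
      refine Finset.sum_eq_zero fun p _ => ?_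
      rw [map_smul, hφA, smul_zero]

/-- A matrix of linear forms with finitely many rows, which have linear quotients. -/
structure LinearMatrix (K : Type*) [Field K] (n : ℕ) (col : Type) where
  /-- the index set of the rows -/
  row : Type
  /-- the set of rows is finite -/
  fintypeRow : Fintype row
  /-- the order of the rows -/
  linearOrderRow : LinearOrder row
  /-- the matrix -/
  mat : Matrix row col (MvPolynomial (Fin n) K)
  /-- the variables generating the colon ideals -/
  vars : row → Finset (Fin n)
  isHomogeneous : ∀ p q, (mat p q).IsHomogeneous 1
  quotients : ModuleQuotients K (fun p => mat p) vars

attribute [instance] LinearMatrix.fintypeRow LinearMatrix.linearOrderRow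

theorem LinearMatrix.exists_next {col : Type} (A : LinearMatrix K n col) :
    ∃ B : LinearMatrix K n A.row, ∀ v : A.row → MvPolynomial (Fin n) K,
      Matrix.vecMul v A.mat = 0 ↔ ∃ w, v = Matrix.vecMul w B.mat := by
  obtain ⟨β', h1, h2, B, V', h3, h4, h5⟩ :=
    A.quotients.exists_syzygies (A.quotients.hasLinearRelations A.isHomogeneous)
  refine ⟨⟨β', h1, h2, B, V', h3, h4⟩, fun v => ?_⟩
  rw [Matrix.vecMul_eq_sum]
  exact h5 v

/-- A matrix of linear syzygies of the rows of `A`. -/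
def LinearMatrix.next {col : Type} (A : LinearMatrix K n col) : LinearMatrix K n A.row :=
  A.exists_next.choose

/-- The matrices obtained by taking syzygies repeatedly. -/
def LinearMatrix.iterNext {col : Type} (A : LinearMatrix K n col) :
    ℕ → Σ γ : Type, LinearMatrix K n γ
  | 0 => ⟨col, A⟩
  | i + 1 => ⟨_, (A.iterNext i).2.next⟩

theorem ModuleQuotients.hasLinearResolution {β : Type} [Fintype β] [LinearOrder β]
    {g : β → MvPolynomial (Fin n) K} {V : β → Finset (Fin n)} (hq : ModuleQuotients K g V)
    (hlin : HasLinearRelations K g V) {d : ℕ} (hg : ∀ i, (g i).IsHomogeneous d) :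
    HasLinearResolution d (Ideal.span (Set.range g)) := by
  obtain ⟨β', h1, h2, B, V', h3, h4, h5⟩ := hq.exists_syzygies hlin
  let A : LinearMatrix K n β := ⟨β', h1, h2, B, V', h3, h4⟩
  refine ⟨fun i => (A.iterNext i).1,
    -- The column type of stage `0` is `β` by definition; that of stage `i + 1` is the row type of
    -- stage `i`.
    fun i => match i with
      | 0 => inferInstanceAs (Fintype β)
      | i + 1 => (A.iterNext i).2.fintypeRow, g, fun i => (A.iterNext i).2.mat, hg,
    fun i => (A.iterNext i).2.isHomogeneous, rfl, h5, fun i v => ?_⟩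
  exact (A.iterNext i).2.exists_next.choose_spec v

/-- As all `u i` have degree `d`, an earlier `u j` dividing `x_s u_i` has a single variable as
cofactor, so the required linear relation is `x_s u_i = x_t u_j`. -/
theorem MonomialQuotients.hasLinearResolution {β : Type} [Fintype β] [LinearOrder β]
    {u : β → Fin n →₀ ℕ} {V : β → Finset (Fin n)} (h : MonomialQuotients u V) {d : ℕ}
    (hd : ∀ i, (u i).degree = d) :
    HasLinearResolution d (Ideal.span (Set.range fun i => monomial (u i) (1 : K))) := by
  classical
  refine ModuleQuotients.hasLinearResolution (V := V) (fun i f => h.mul_monomial_mem_span_iff i f)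
    (fun i s hs => ?_) (fun i => isHomogeneous_monomial _ (hd i))
  obtain ⟨j, hj, hle⟩ := (h i (Finsupp.single s 1)).mpr ⟨s, hs, by simp⟩
  obtain ⟨e, he⟩ := exists_add_of_le hle
  obtain ⟨t, rfl⟩ := exists_eq_single_of_degree_eq_one (a := e) (by
    have := congrArg Finsupp.degree he
    rw [map_add, map_add, hd, hd, Finsupp.degree_single] at this
    omega)
  refine ⟨Pi.single j (X t), fun l => ?_, fun l hl => ?_, ?_⟩
  · rw [Pi.single_apply]
    split_ifs
    · exact isHomogeneous_X _ _
    · exact isHomogeneous_zero _ _ _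
  · rw [Pi.single_apply, if_neg]
    rintro rfl
    exact hl hj
  · rw [Finset.sum_eq_single j (fun l _ hl => by simp [hl]) (by simp), Pi.single_eq_same,
      smul_eq_mul, smul_eq_mul, X, X, monomial_mul, monomial_mul, he, add_comm]

end Syzygies

/-! ### The two conclusions for symbolic powers -/

section Main

variable {K : Type*} [Field K] {n : ℕ} {I : Ideal (MvPolynomial (Fin n) K)}

theorem hasLinearQuotients_symbolicPower (hmin : IsMinimalIntersectionType I)
    (hcov : HasLinearCoverFunction I) (hx : XCondition I (OrderTLT I)) (k : ℕ) :
    HasLinearQuotients (symbolicPower I k) := by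
  obtain ⟨r, u, V, hinj, hrange, -, h⟩ := exists_monomialQuotients hmin hcov hx k
  exact h.hasLinearQuotients (hmin.mem_symbolicPower_iff_monomial k) hinj hrange

theorem isComponentwiseLinear_symbolicPower (hmin : IsMinimalIntersectionType I)
    (hcov : HasLinearCoverFunction I) (hx : XCondition I (OrderTLT I)) (k : ℕ) :
    IsComponentwiseLinear (symbolicPower I k) := by
  have hJ := hmin.mem_symbolicPower_iff_monomial k
  refine ⟨fun f hf d => homogeneousComponent_mem_of_mem_iff hJ hf d, fun d => ?_⟩
  obtain ⟨r, u, V, -, hrange, hmono, h⟩ := exists_monomialQuotients hmin hcov hx k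
  obtain ⟨β, _, _, u', V', h', hrange'⟩ := h.exists_degreePart hmono d
  have hu' : Set.range u' = {a | a.degree = d ∧ monomial a (1 : K) ∈ symbolicPower I k} := by
    rw [hrange']
    ext a
    refine and_congr_right fun _ => ⟨?_, fun ha => ?_⟩
    · rintro ⟨i, hi⟩
      have hui : u i ∈ minGens (symbolicPower I k) := hrange ▸ Set.mem_range_self i
      exact monomial_mem_of_le hi hui.1
    · obtain ⟨b, hb, hba⟩ := exists_mem_minGens_le ha
      rw [← hrange] at hb
      obtain ⟨i, rfl⟩ := hb
      exact ⟨i, hba⟩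
  rw [← gradedPartIdeal_eq_span hJ hu']
  refine h'.hasLinearResolution fun i => ?_
  have hi : u' i ∈ {a | a.degree = d ∧ monomial a (1 : K) ∈ symbolicPower I k} :=
    hu' ▸ Set.mem_range_self i
  exact hi.1

end Main

end

end SymbolicXCondition

theorem theorem2p2 {K : Type*} [Field K] {n : ℕ} (I : Ideal (MvPolynomial (Fin n) K))
    (hI : SymbolicXCondition.IsMonomialIdeal I)
    (hmin : SymbolicXCondition.IsMinimalIntersectionType I)
    (hcov : SymbolicXCondition.HasLinearCoverFunction I)
    (hx : SymbolicXCondition.XCondition I (SymbolicXCondition.OrderTLT I)) :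
    (∀ k : ℕ, 1 ≤ k →
      SymbolicXCondition.HasLinearQuotients (SymbolicXCondition.symbolicPower I k)) ∧
    (∀ k : ℕ, 1 ≤ k →
      SymbolicXCondition.IsComponentwiseLinear (SymbolicXCondition.symbolicPower I k)) := by
  exact ⟨fun k _ => SymbolicXCondition.hasLinearQuotients_symbolicPower hmin hcov hx k,
    fun k _ => SymbolicXCondition.isComponentwiseLinear_symbolicPower hmin hcov hx k⟩
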